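/- **Setting.** Let $\Omega=(0,2\pi)^2$ and let $H$ be the space of real vector fields in $L^2(\Omega)^2$ that are $2\pi$-periodic in each direction, mean-free, and divergence-free in the sense of (periodic) distributions, with norm $|u|^2=\int_\Omega|u|^2dx$. Let $V$ (resp. $D(A)$) be the space of $u\in H$ whose weak derivatives up to order $1$ (resp. $2$) are square integrable, $\mathbb P$ the orthogonal (Leray) projection of $L^2(\Omega)^2$ onto $H$, $A=-\mathbb P\Delta$, $B(u,v)=\mathbb P((u\cdot\nabla)v)$, and, for real $N>0$, $P_N$ the projection of $H$ onto the Fourier modes with wavenumbers $|k|\le N$. Fix a viscosity $\nu>0$. A *strong solution* of $\frac{du}{dt}+\nu Au+B(u,u)=F$, $u(0)=u_0\in V$, is a function $u$ such that, for all $T>0$, $u\in C([0,T];V)\cap L^2(0,T;D(A))$ and $\frac{du}{dt}\in L^2(0,T;H)$, which satisfies the equation in $H$ for a.e. $t>0$. For $f\in L^\infty(0,\infty;H)$ write $|f|=\operatorname{ess\,sup}_{t>0}|f(t)|$; limits as $t\to\infty$ of such forces are understood up to null sets of times. The *2D Navier–Stokes equation* with force $f$ is $$\tfrac{du}{dt}+\nu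 Au+B(u,u)=f,\qquad u(0)=u_0, \tag{NSE}$$ and the *nudging filter* with parameters $\mu\in\mathbb R$, $N>0$ is the system $$\tfrac{dv}{dt}+\nu Av+B(v,v)=f-\mu P_Nv+\mu P_Nu,\quad v(0)=v_0;\qquad \tfrac{du}{dt}+\nu Au+B(u,u)=f,\quad u(0)=u_0. \tag{F}$$ * (F) has the **synchronization property** if there are a nondecreasing function $\mu_*:(0,\infty)\to\mathbb R$, independent of $f$, and a number $N_*=N_*(|f|,\nu)>0$ depending continuously on $|f|$ and $\nu$, such that for every $f\in L^\infty(0,\infty;H)$, all $N\ge N_*$, all $\mu\in[\mu_*(N_*),\mu_*(N)]$ and all $u_0,v_0\in V$, the strong solutions of (F) satisfy $|v(t)-u(t)|\to0$ as $t\to\infty$. * (NSE) has the **finite determining modes property** if for all $f_1,f_2\in L^\infty(0,\infty;H)$ there is $N>0$ such that, for all $u_0^1,u_0^2\in V$, the strong solutions $u_1,u_2$ of (NSE) with data $(f_1,u_0^1)$, $(f_2,u_0^2)$ satisfy: if $|P_Nu_1(t)-P_Nu_2(t)|\to0$ and $|f_1(t)-f_2(t)|\to0$ as $t\to\infty$,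 then $|u_1(t)-u_2(t)|\to0$ as $t\to\infty$. * For $M=(m_{ij})\in\mathbb R^{2\times2}$ and $F_1,F_2:V\to H$ with $F_j(0)=0$, the *intertwined system* with forces $g_1,g_2$ is $\frac{dv_i}{dt}+\nu Av_i+B(v_i,v_i)=g_i+m_{i1}F_1(v_1)+m_{i2}F_2(v_2)$, $i=1,2$. It is **finite-dimensionally assisted self-synchronous** if for all $g_1,g_2\in L^\infty(0,\infty;H)$ there is $N>0$ such that, for all initial data $v_0^1,v_0^2\in V$, the conditions $|P_Nv_1(t)-P_Nv_2(t)|\to0$ and $|g_1(t)-g_2(t)|\to0$ imply $|v_1(t)-v_2(t)|\to0$ as $t\to\infty$. The *trivial intertwinement* is the case $F_1=F_2\equiv0$ (where $M$ is irrelevant). **Theorem.** Let $\nu>0$. If the nudging filter (F) has the synchronization property, then (NSE) has the finite determining modes property. Equivalently, if the nudging filter (F) has the synchronization property, then the trivial intertwinement is finite-dimensionally assisted self-synchronous; indeed, (NSE) has the finite determining modes property if and only if the trivial intertwinement is finite-dimensionally assisted self-synchronous. -/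

import Mathlib

open MeasureTheory Set Filter Topology
open scoped ContDiff ENNReal

noncomputable section

namespace NSE

/-! ### Function spaces of periodic planar vector fields -/

/-- The plane `ℝ²` with its Euclidean structure. -/
abbrev Plane : Type := EuclideanSpace ℝ (Fin 2)

/-- The period cell `Ω = (0, 2π)²`. -/
def cell : Set Plane := {x | ∀ j, x j ∈ Ioo (0 : ℝ) (2 * Real.pi)}

/-- Lebesgue measure on the period cell. -/
def cellMeasure : Measure Plane := volume.restrict cell

theorem isBounded_cell : Bornology.IsBounded cell := by
  have hc : IsCompact ((EuclideanSpace.equiv (Fin 2) ℝ).symm ''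
      (Set.pi univ fun _ : Fin 2 => Icc (0 : ℝ) (2 * Real.pi))) :=
    (isCompact_univ_pi fun _ => isCompact_Icc).image
      (EuclideanSpace.equiv (Fin 2) ℝ).symm.continuous
  refine hc.isBounded.subset fun x hx => ?_
  exact ⟨EuclideanSpace.equiv (Fin 2) ℝ x, fun j _ => Ioo_subset_Icc_self (hx j), by simp⟩

theorem measurableSet_cell : MeasurableSet cell := by
  have : cell = ⋂ j, {x : Plane | x j ∈ Ioo (0 : ℝ) (2 * Real.pi)} := by ext; simp [cell]
  rw [this]
  exact MeasurableSet.iInter fun j =>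
    (by fun_prop : Measurable fun x : Plane => x j) measurableSet_Ioo

instance : IsFiniteMeasure cellMeasure :=
  ⟨by simpa [cellMeasure] using isBounded_cell.measure_lt_top (μ := volume)⟩

/-- `L²` vector fields on the period cell (equivalently, `2π`-periodic, locally square integrable
vector fields). The norm is `|u|² = ∫_Ω |u(x)|² dx`. -/
abbrev L2 : Type := Lp Plane 2 cellMeasure

/-- Smooth real functions on the plane that are `2π`-periodic in each direction. -/
def IsTest (φ : Plane → ℝ) : Prop :=
  ContDiff ℝ ∞ φ ∧ ∀ (j : Fin 2) (x : Plane),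
    φ (x + EuclideanSpace.single j (2 * Real.pi)) = φ x

/-- The classical partial derivative `∂_j φ`. -/
def partialDeriv (j : Fin 2) (φ : Plane → ℝ) (x : Plane) : ℝ :=
  fderiv ℝ φ x (EuclideanSpace.single j 1)

/-- `u` has mean zero over the period cell. -/
def IsMeanFree (u : L2) : Prop := ∫ x, u x ∂cellMeasure = 0

/-- `∇ · u = 0` in the sense of (periodic) distributions. -/
def IsDivFree (u : L2) : Prop :=
  ∀ φ : Plane → ℝ, IsTest φ → ∫ x, ∑ j, partialDeriv j φ x * u x j ∂cellMeasure = 0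

/-- `g` is the weak (periodic) partial derivative `∂_j u`. -/
def HasWeakPartial (j : Fin 2) (u g : L2) : Prop :=
  ∀ φ : Plane → ℝ, IsTest φ →
    ∫ x, partialDeriv j φ x • u x ∂cellMeasure = - ∫ x, φ x • g x ∂cellMeasure

open Classical in
/-- The weak partial derivative `∂_j u` (zero if it does not exist in `L²`). -/
def weakPartial (j : Fin 2) (u : L2) : L2 :=
  if h : ∃ g, HasWeakPartial j u g then h.choose else 0

/-! Integration against a continuous family of linear maps is continuous on `L²`; this yields that
the spaces below are closed. -/

theorem integrable_apply {F : Type*} [NormedAddCommGroup F] [NormedSpace ℝ F]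
    (L : Plane → Plane →L[ℝ] F) (hL : Continuous L) (u : L2) :
    Integrable (fun x => L x (u x)) cellMeasure := by
  obtain ⟨C, hC⟩ := isBounded_cell.isCompact_closure.exists_bound_of_continuousOn hL.continuousOn
  have hu : Integrable (u : Plane → Plane) cellMeasure :=
    (Lp.memLp u).integrable (by norm_num)
  have hmeas : AEStronglyMeasurable (fun x => L x (u x)) cellMeasure :=
    isBoundedBilinearMap_apply.continuous.comp_aestronglyMeasurable
      (f := fun x => (L x, u x)) (hL.aestronglyMeasurable.prodMk hu.aestronglyMeasurable)
  refine (hu.norm.const_mul C).mono' hmeas ?_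
  refine (ae_restrict_mem measurableSet_cell).mono fun x hx => ?_
  exact (L x).le_of_opNorm_le (hC x (subset_closure hx)) _

theorem continuous_integral_apply {F : Type*} [NormedAddCommGroup F] [NormedSpace ℝ F]
    (L : Plane → Plane →L[ℝ] F) (hL : Continuous L) :
    Continuous fun u : L2 => ∫ x, L x (u x) ∂cellMeasure := by
  obtain ⟨C, hC⟩ := isBounded_cell.isCompact_closure.exists_bound_of_continuousOn hL.continuousOn
  let T : L2 →ₗ[ℝ] F :=
    { toFun := fun u => ∫ x, L x (u x) ∂cellMeasure
      map_add' := fun u v => by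
        rw [← integral_add (integrable_apply L hL u) (integrable_apply L hL v)]
        refine integral_congr_ae ((Lp.coeFn_add u v).mono fun x hx => ?_)
        simp only [hx, Pi.add_apply, map_add]
      map_smul' := fun c u => by
        rw [RingHom.id_apply, ← integral_smul]
        refine integral_congr_ae ((Lp.coeFn_smul c u).mono fun x hx => ?_)
        simp only [hx, Pi.smul_apply, map_smul] }
  refine (T.mkContinuous (max C 0 * (cellMeasure.real univ) ^ (1 / 2 : ℝ)) fun u => ?_).continuous
  have h1 : ‖T u‖ ≤ ∫ x, max C 0 * ‖u x‖ ∂cellMeasure := by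
    refine norm_integral_le_of_norm_le
      ((((Lp.memLp u).integrable (by norm_num)).norm).const_mul _) ?_
    refine (ae_restrict_mem measurableSet_cell).mono fun x hx => ?_
    exact (L x).le_of_opNorm_le ((hC x (subset_closure hx)).trans (le_max_left _ _)) _
  have h2 : ∫ x, ‖u x‖ ∂cellMeasure ≤ ‖u‖ * (cellMeasure.real univ) ^ (1 / 2 : ℝ) := by
    have h3 := eLpNorm_le_eLpNorm_mul_rpow_measure_univ (μ := cellMeasure) (p := 1) (q := 2)
      (by norm_num) (Lp.memLp u).aestronglyMeasurable
    rw [integral_norm_eq_lintegral_enorm (Lp.memLp u).aestronglyMeasurable,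
      ← eLpNorm_one_eq_lintegral_enorm, Lp.norm_def, Measure.real, ENNReal.toReal_rpow,
      ← ENNReal.toReal_mul]
    refine ENNReal.toReal_mono (ENNReal.mul_ne_top (Lp.eLpNorm_ne_top u)
      (ENNReal.rpow_ne_top_of_nonneg (by norm_num) (measure_ne_top _ _))) ?_
    convert h3 using 3
    norm_num
  rw [integral_const_mul] at h1
  calc ‖T u‖ ≤ max C 0 * (‖u‖ * (cellMeasure.real univ) ^ (1 / 2 : ℝ)) :=
        h1.trans (mul_le_mul_of_nonneg_left h2 (le_max_right _ _))
    _ = _ := by ring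

/-- The operator `y ↦ ∑_j a_j y_j` on the plane. -/
def pairing (a : Fin 2 → ℝ) : Plane →L[ℝ] ℝ := ∑ j, a j • EuclideanSpace.proj j

theorem continuous_partialDeriv {φ : Plane → ℝ} (hφ : IsTest φ) (j : Fin 2) :
    Continuous (partialDeriv j φ) :=
  (hφ.1.continuous_fderiv (by simp)).clm_apply continuous_const

theorem continuous_pairing {φ : Plane → ℝ} (hφ : IsTest φ) :
    Continuous fun x => pairing fun j => partialDeriv j φ x := by
  unfold pairing
  exact continuous_finsetSum _ fun j _ => (continuous_partialDeriv hφ j).smul continuous_const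

theorem isDivFree_iff (u : L2) : IsDivFree u ↔ ∀ φ : Plane → ℝ, IsTest φ →
    ∫ x, (pairing fun j => partialDeriv j φ x) (u x) ∂cellMeasure = 0 := by
  simp [IsDivFree, pairing]

/-- The space `H` of square integrable, `2π`-periodic, divergence-free, mean-free vector fields,
a closed subspace of `L2`. -/
def H : Submodule ℝ L2 where
  carrier := {u | IsMeanFree u ∧ IsDivFree u}
  zero_mem' := by
    have h0 := Lp.coeFn_zero Plane 2 cellMeasure
    refine ⟨?_, fun φ _ => ?_⟩
    · unfold IsMeanFree
      rw [integral_congr_ae h0]; simp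
    · rw [integral_congr_ae (g := fun _ => (0 : ℝ)) (h0.mono fun x hx => by
        simp only [hx, Pi.zero_apply, PiLp.zero_apply, mul_zero, Finset.sum_const_zero])]; simp
  add_mem' := by
    rintro u v ⟨hu, hu'⟩ ⟨hv, hv'⟩
    refine ⟨?_, (isDivFree_iff _).2 fun φ hφ => ?_⟩
    · unfold IsMeanFree at *
      rw [integral_congr_ae (Lp.coeFn_add u v)]
      simp only [Pi.add_apply]
      rw [integral_add ((Lp.memLp u).integrable (by norm_num))
        ((Lp.memLp v).integrable (by norm_num)), hu, hv, add_zero]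
    · rw [integral_congr_ae (g := fun x => (pairing fun j => partialDeriv j φ x) (u x) +
        (pairing fun j => partialDeriv j φ x) (v x))
        ((Lp.coeFn_add u v).mono fun x hx => by simp only [hx, Pi.add_apply, map_add]),
        integral_add (integrable_apply _ (continuous_pairing hφ) u)
          (integrable_apply _ (continuous_pairing hφ) v),
        (isDivFree_iff u).1 hu' φ hφ, (isDivFree_iff v).1 hv' φ hφ, add_zero]
  smul_mem' := by
    rintro c u ⟨hu, hu'⟩
    refine ⟨?_, (isDivFree_iff _).2 fun φ hφ => ?_⟩
    · unfold IsMeanFree at *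
      rw [integral_congr_ae (Lp.coeFn_smul c u)]
      simp only [Pi.smul_apply]
      rw [integral_smul, hu, smul_zero]
    · rw [integral_congr_ae (g := fun x => c • (pairing fun j => partialDeriv j φ x) (u x))
        ((Lp.coeFn_smul c u).mono fun x hx => by simp only [hx, Pi.smul_apply, map_smul]),
        integral_smul, (isDivFree_iff u).1 hu' φ hφ, smul_zero]

theorem isClosed_H : IsClosed (H : Set L2) := by
  have : (H : Set L2) = {u | ∫ x, (ContinuousLinearMap.id ℝ Plane) (u x) ∂cellMeasure = 0} ∩
      ⋂ (φ : Plane → ℝ) (_ : IsTest φ),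
        {u | ∫ x, (pairing fun j => partialDeriv j φ x) (u x) ∂cellMeasure = 0} := by
    ext u
    change IsMeanFree u ∧ IsDivFree u ↔ _
    simp [isDivFree_iff, IsMeanFree]
  rw [this]
  refine (isClosed_eq (continuous_integral_apply (fun _ => ContinuousLinearMap.id ℝ Plane)
    continuous_const) continuous_const).inter ?_
  exact isClosed_iInter fun φ => isClosed_iInter fun hφ =>
    isClosed_eq (continuous_integral_apply _ (continuous_pairing hφ)) continuous_const

instance : CompleteSpace H := isClosed_H.completeSpace_coe

/-- The Leray projection: the orthogonal projection of `L2` onto `H`. -/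
def leray : L2 →L[ℝ] H := H.orthogonalProjectionOnto

/-- Membership in `V`: all first-order weak derivatives are in `L²`. -/
def InV (u : H) : Prop := ∀ j, ∃ g, HasWeakPartial j u g

/-- Membership in the domain `D(A)` of the Stokes operator: all weak derivatives up to order two
are in `L²`. -/
def InDA (u : H) : Prop := InV u ∧ ∀ i j, ∃ g, HasWeakPartial i (weakPartial j u) g

/-- The Stokes operator `A = -ℙΔ` (meaningful on `D(A)`). -/
def stokes (u : H) : H := - leray (∑ j, weakPartial j (weakPartial j u))

/-- The vector field `(u · ∇) v`. -/
def advect (u v : H) (x : Plane) : Plane := ∑ j, (u : L2) x j • (weakPartial j v : L2) x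

open Classical in
/-- The bilinear term `B(u, v) = ℙ((u · ∇) v)` (meaningful when `(u · ∇) v` is in `L²`, in
particular for `u ∈ D(A)` and `v ∈ V`). -/
def bilin (u v : H) : H :=
  if h : MemLp (advect u v) 2 cellMeasure then leray (h.toLp (advect u v)) else 0

/-! ### Spectral projections -/

/-- The wave vector `k ∈ ℤ²` as an element of the plane. -/
def waveVec (k : Fin 2 → ℤ) : Plane := WithLp.toLp 2 fun j => (k j : ℝ)

/-- The Fourier coefficient `û_k = (2π)⁻² ∫_Ω e^{-i k·x} u(x) dx ∈ ℂ²`. -/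
def fourierCoeff (u : L2) (k : Fin 2 → ℤ) (j : Fin 2) : ℂ :=
  (2 * Real.pi : ℂ)⁻¹ ^ 2 *
    ∫ x, Complex.exp (-Complex.I * (inner ℝ (waveVec k) x : ℝ)) * (u x j : ℂ) ∂cellMeasure

/-- The linear map `y ↦ e^{-i k·x} y_j`. -/
def fourierMap (k : Fin 2 → ℤ) (j : Fin 2) (x : Plane) : Plane →L[ℝ] ℂ :=
  Complex.exp (-Complex.I * (inner ℝ (waveVec k) x : ℝ)) •
    (Complex.ofRealCLM.comp (EuclideanSpace.proj j))

theorem continuous_fourierMap (k : Fin 2 → ℤ) (j : Fin 2) : Continuous (fourierMap k j) := by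
  unfold fourierMap
  have h : Continuous fun x : Plane => inner ℝ (waveVec k) x := continuous_const.inner continuous_id
  exact (Complex.continuous_exp.comp
    (continuous_const.mul (Complex.continuous_ofReal.comp h))).smul continuous_const

theorem fourierCoeff_eq (u : L2) (k : Fin 2 → ℤ) (j : Fin 2) :
    fourierCoeff u k j =
      (2 * Real.pi : ℂ)⁻¹ ^ 2 * ∫ x, fourierMap k j x (u x) ∂cellMeasure := by
  simp [fourierCoeff, fourierMap]

/-- The fields in `H` whose Fourier coefficients vanish at all wavenumbers `|k| > N`. -/
def lowModes (N : ℝ) : Submodule ℝ H where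
  carrier := {u | ∀ k : Fin 2 → ℤ, N < ‖waveVec k‖ → ∀ j, fourierCoeff u k j = 0}
  zero_mem' := fun k _ j => by
    rw [fourierCoeff_eq, integral_congr_ae (g := fun _ => (0 : ℂ))
      ((Lp.coeFn_zero Plane 2 cellMeasure).mono fun x hx => by
        change fourierMap k j x ((0 : L2) x) = 0
        simp only [hx, Pi.zero_apply, map_zero])]
    simp
  add_mem' := fun {u v} hu hv k hk j => by
    have h1 := hu k hk j
    have h2 := hv k hk j
    rw [fourierCoeff_eq] at h1 h2 ⊢
    rw [integral_congr_ae (g := fun x => fourierMap k j x ((u : L2) x) +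
        fourierMap k j x ((v : L2) x))
      ((Lp.coeFn_add (u : L2) (v : L2)).mono fun x hx => by
        change fourierMap k j x (((u : L2) + (v : L2) : L2) x) = _
        simp only [hx, Pi.add_apply, map_add]),
      integral_add (integrable_apply _ (continuous_fourierMap k j) _)
        (integrable_apply _ (continuous_fourierMap k j) _), mul_add, h1, h2, add_zero]
  smul_mem' := fun c u hu k hk j => by
    have h1 := hu k hk j
    rw [fourierCoeff_eq] at h1 ⊢
    rw [integral_congr_ae (g := fun x => c • fourierMap k j x ((u : L2) x))
      ((Lp.coeFn_smul c (u : L2)).mono fun x hx => by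
        change fourierMap k j x ((c • (u : L2) : L2) x) = _
        simp only [hx, Pi.smul_apply, map_smul]), integral_smul, mul_smul_comm, h1, smul_zero]

theorem isClosed_lowModes (N : ℝ) : IsClosed (lowModes N : Set H) := by
  have : (lowModes N : Set H) = ⋂ (k : Fin 2 → ℤ) (_ : N < ‖waveVec k‖) (j : Fin 2),
      {u : H | (2 * Real.pi : ℂ)⁻¹ ^ 2 *
        ∫ x, fourierMap k j x ((u : L2) x) ∂cellMeasure = 0} := by
    ext u
    change (∀ k : Fin 2 → ℤ, N < ‖waveVec k‖ → ∀ j, fourierCoeff u k j = 0) ↔ _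
    simp only [fourierCoeff_eq, mem_iInter, mem_ofPred_eq]
  rw [this]
  refine isClosed_iInter fun k => isClosed_iInter fun _ => isClosed_iInter fun j =>
    isClosed_eq (continuous_const.mul ?_) continuous_const
  exact (continuous_integral_apply _ (continuous_fourierMap k j)).comp continuous_subtype_val

instance (N : ℝ) : CompleteSpace (lowModes N) := (isClosed_lowModes N).completeSpace_coe

/-- `P_N`: the projection of `H` onto the Fourier modes with wavenumbers `|k| ≤ N`. -/
def PN (N : ℝ) : H →L[ℝ] H := (lowModes N).starProjection

/-! ### The Navier-Stokes equations and the nudging filter -/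

/-- `f ∈ L^∞(0, ∞; H)`. -/
def IsForce (f : ℝ → H) : Prop := MemLp f ∞ (volume.restrict (Ioi (0 : ℝ)))

/-- `|f| = ess sup_{t > 0} |f(t)|`. -/
def forceNorm (f : ℝ → H) : ℝ := (eLpNorm f ∞ (volume.restrict (Ioi (0 : ℝ)))).toReal

/-- Convergence to zero in `H` as `t → ∞` of an element of `L^∞(0, ∞; H)`, i.e. up to a null set
of times. -/
def ForceTendsToZero (h : ℝ → H) : Prop :=
  Tendsto (fun t => ‖h t‖) (atTop ⊓ ae (volume : Measure ℝ)) (𝓝 0)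

/-- `u` is a global strong solution of `du/dt + νAu + B(u,u) = F`, `u(0) = u₀ ∈ V`:
`u ∈ C([0,T]; V) ∩ L²(0,T; D(A))` and `du/dt ∈ L²(0,T; H)` for all `T > 0`, and the equation holds
in `H` for almost every `t > 0`. -/
structure IsStrongSolution (ν : ℝ) (F : ℝ → H) (u₀ : H) (u : ℝ → H) : Prop where
  init_mem : InV u₀
  init : u 0 = u₀
  mem_V : ∀ t, 0 ≤ t → InV (u t)
  continuous_H : ContinuousOn u (Ici 0)
  continuous_V : ∀ j, ContinuousOn (fun t => weakPartial j (u t : L2)) (Ici 0)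
  mem_DA : ∀ᵐ t ∂volume.restrict (Ioi (0 : ℝ)), InDA (u t)
  memLp_DA : ∀ T, 0 < T → MemLp (fun t => stokes (u t)) 2 (volume.restrict (Ioo 0 T))
  equation : ∃ u' : ℝ → H,
    (∀ T, 0 < T → MemLp u' 2 (volume.restrict (Ioo 0 T))) ∧
    (∀ t, 0 ≤ t → u t = u₀ + ∫ s in (0 : ℝ)..t, u' s) ∧
    ∀ᵐ t ∂volume.restrict (Ioi (0 : ℝ)), u' t + ν • stokes (u t) + bilin (u t) (u t) = F t

/-- `(v, u)` is the strong solution of the nudging filter with external force `f`, nudging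
parameter `μ`, cut-off `N` and initial data `(v₀, u₀)`. -/
def IsNudgingSolution (ν μ N : ℝ) (f : ℝ → H) (v₀ u₀ : H) (v u : ℝ → H) : Prop :=
  IsStrongSolution ν (fun t => f t - μ • PN N (v t) + μ • PN N (u t)) v₀ v ∧
  IsStrongSolution ν f u₀ u

/-- The synchronization property of the nudging filter. -/
def NudgingSynchronization (ν : ℝ) : Prop :=
  ∃ (μstar : ℝ → ℝ) (Nstar : ℝ × ℝ → ℝ),
    MonotoneOn μstar (Ioi 0) ∧
    ContinuousOn Nstar (Ici 0 ×ˢ Ioi 0) ∧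
    (∀ p ∈ (Ici 0 ×ˢ Ioi 0 : Set (ℝ × ℝ)), 0 < Nstar p) ∧
    ∀ f : ℝ → H, IsForce f →
      ∀ N, Nstar (forceNorm f, ν) ≤ N →
      ∀ μ ∈ Icc (μstar (Nstar (forceNorm f, ν))) (μstar N),
      ∀ (v₀ u₀ : H) (v u : ℝ → H), IsNudgingSolution ν μ N f v₀ u₀ v u →
        Tendsto (fun t => ‖v t - u t‖) atTop (𝓝 0)

/-- The finite determining modes property of the 2D Navier-Stokes equations. -/
def DeterminingModes (ν : ℝ) : Prop :=
  ∀ f₁ f₂ : ℝ → H, IsForce f₁ → IsForce f₂ →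
    ∃ N : ℝ, 0 < N ∧
      ∀ (u₀₁ u₀₂ : H) (u₁ u₂ : ℝ → H),
        IsStrongSolution ν f₁ u₀₁ u₁ → IsStrongSolution ν f₂ u₀₂ u₂ →
        Tendsto (fun t => ‖PN N (u₁ t) - PN N (u₂ t)‖) atTop (𝓝 0) →
        ForceTendsToZero (fun t => f₁ t - f₂ t) →
        Tendsto (fun t => ‖u₁ t - u₂ t‖) atTop (𝓝 0)

/-! ### Intertwinements -/

/-- `(v₁, v₂)` is the solution of the intertwined Navier-Stokes system with external forces
`(g₁, g₂)`, intertwining matrix `M` and intertwining function `F = (F₁, F₂)`. The values of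
`F` are only used on `V`. -/
def IsIntertwinedSolution (ν : ℝ) (M : Matrix (Fin 2) (Fin 2) ℝ) (F : Fin 2 → H → H)
    (g : Fin 2 → ℝ → H) (v₀ : Fin 2 → H) (v : Fin 2 → ℝ → H) : Prop :=
  ∀ i, IsStrongSolution ν (fun t => g i t + ∑ j, M i j • F j (v j t)) (v₀ i) (v i)

/-- The intertwinement with matrix `M` and function `F` is finite-dimensionally assisted
self-synchronous. -/
def FiniteDimAssistedSelfSynchronous (ν : ℝ) (M : Matrix (Fin 2) (Fin 2) ℝ)
    (F : Fin 2 → H → H) : Prop :=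
  ∀ g : Fin 2 → ℝ → H, (∀ i, IsForce (g i)) →
    ∃ N : ℝ, 0 < N ∧
      ∀ (v₀ : Fin 2 → H) (v : Fin 2 → ℝ → H), IsIntertwinedSolution ν M F g v₀ v →
        Tendsto (fun t => ‖PN N (v 0 t) - PN N (v 1 t)‖) atTop (𝓝 0) →
        ForceTendsToZero (fun t => g 0 t - g 1 t) →
        Tendsto (fun t => ‖v 0 t - v 1 t‖) atTop (𝓝 0)

/-- The trivial intertwinement `F ≡ 0` (for which the matrix plays no role) is
finite-dimensionally assisted self-synchronous. -/
def TrivialSelfSynchronous (ν : ℝ) : Prop :=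
  ∀ M : Matrix (Fin 2) (Fin 2) ℝ, FiniteDimAssistedSelfSynchronous ν M (fun _ _ => 0)

end NSE

end

noncomputable section

namespace NSE

/-! ### The Fourier basis on the period cell -/

/-! The mathematical content is the Foias–Prodi theorem: for every `ν > 0`, finitely many Fourier
modes determine the large-time behaviour (`determiningModes`). The two conclusions about determining
modes and about the trivial intertwinement then follow, since with zero intertwining functions the
coupled system is just two copies of (NSE).

For two solutions put `w = u₁ - u₂`, `D = |∇w|`, `E = |∇u₁|`. Pairing the difference equation with
`w`, the only surviving part of the nonlinearity is `∫ (w·∇)u₁ · w`, which Ladyzhenskaya's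
inequality bounds by `12 |w| D E`. Young's inequality spends half of the dissipation `2ν D²` on it
and leaves `(144/ν) E² |w|²`. The other half is at least `ν N² (|w|² - |P_N w|²)` by the spectral
gap (`inner_difference_le`).

The difficulty is that `E(t)²` is controlled only in time average. The weight `exp(144 ν⁻² |u₁|²)`
deals with this: by the energy inequality (`inner_energy_le`) its logarithmic derivative is at most
`-(144/ν) E² + G` with `G = 144 |f₁|² / ν³`, so the uncontrolled term cancels exactly. Choosing `ν
N² = 1 + G`, the weighted quantity `z` satisfies `z' ≤ -z + o(1)`, hence tends to zero
(`tendsto_zero_of_gronwall`). The weight is at least one, so `|w|` tends to zero too.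

The analytic input is obtained from Fourier series. Weak derivatives become the relation
`IsFourierDeriv` between coefficients, which yields integration by parts, the Poincaré inequality
and the spectral gap by Parseval. The `L⁴` bound and the vanishing of `∫ (u·∇)w · w` are checked on
trigonometric polynomials and carried to the limit. -/

theorem measurableSet_boxIoc (r : ℝ) : MeasurableSet {x : Plane | ∀ j, x j ∈ Ioc (0 : ℝ) r} := by
  have : {x : Plane | ∀ j, x j ∈ Ioc (0 : ℝ) r} = ⋂ j, {x : Plane | x j ∈ Ioc (0 : ℝ) r} := by
    ext; simp
  rw [this]
  exact MeasurableSet.iInter fun j =>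
    (by fun_prop : Measurable fun x : Plane => x j) measurableSet_Ioc

theorem ae_coord_ne (j : Fin 2) (a : ℝ) : ∀ᵐ x : Plane, x j ≠ a := by
  have h1 : ∀ᵐ y : Fin 2 → ℝ, y j ≠ a :=
    (Measure.quasiMeasurePreserving_eval (fun _ : Fin 2 => (volume : Measure ℝ)) j).ae
      (Measure.ae_ne volume a)
  exact (PiLp.volume_preserving_ofLp (Fin 2)).quasiMeasurePreserving.ae h1

/-- The faces `x j = 2π` are null sets. The half-open cell is the one that matches
`AddCircle.equivIoc`. -/
theorem cellMeasure_eq_Ioc :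
    cellMeasure = volume.restrict {x : Plane | ∀ j, x j ∈ Ioc (0 : ℝ) (2 * Real.pi)} := by
  refine Measure.restrict_congr_set ?_
  filter_upwards [ae_coord_ne 0 (2 * Real.pi), ae_coord_ne 1 (2 * Real.pi)] with x h0 h1
  refine propext ⟨fun h j => Ioo_subset_Ioc_self (h j),
    fun h j => ⟨(h j).1, lt_of_le_of_ne (h j).2 ?_⟩⟩
  fin_cases j
  exacts [h0, h1]

attribute [local instance] instMeasureSpaceUnitAddCircle

/-- The standard representative in `(0, 2π]²` of a point of the torus. -/
def torusLift (y : UnitAddTorus (Fin 2)) : Plane :=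
  (2 * Real.pi) • WithLp.toLp 2 fun j => (AddCircle.equivIoc 1 0 (y j)).1

/-- The torus is identified with `(0,1]²`, then with a box in the Euclidean plane, then dilated by
`2π`; the Jacobian of the dilation is the factor `(2π)⁻²`. -/
theorem measurePreserving_torusLift : MeasurePreserving torusLift volume
    (ENNReal.ofReal ((2 * Real.pi) ^ 2)⁻¹ • cellMeasure) := by
  have hS : MeasurableSet {x : Fin 2 → ℝ | ∀ i, x i ∈ Ioc (0 : ℝ) (0 + 1)} :=
    MeasurableSet.univ_pi' fun i => measurableSet_Ioc
  have h1 := UnitAddTorus.measurePreserving_equivPiIoc (fun _ : Fin 2 => (0 : ℝ))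
  have h2 := (measurePreserving_subtype_coe (μa := (volume : Measure (Fin 2 → ℝ))) hS).comp h1
  have h3 : MeasurePreserving (WithLp.toLp 2)
      (volume.restrict {x : Fin 2 → ℝ | ∀ i, x i ∈ Ioc (0 : ℝ) (0 + 1)})
      (volume.restrict {x : Plane | ∀ j, x j ∈ Ioc (0 : ℝ) 1}) := by
    have := (PiLp.volume_preserving_toLp (Fin 2)).restrict_preimage (measurableSet_boxIoc 1)
    simpa using this
  have hpos : (0 : ℝ) < 2 * Real.pi := by positivity
  have h4 : MeasurePreserving (fun x : Plane => (2 * Real.pi) • x)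
      (volume.restrict {x : Plane | ∀ j, x j ∈ Ioc (0 : ℝ) 1})
      (ENNReal.ofReal ((2 * Real.pi) ^ 2)⁻¹ • cellMeasure) := by
    have hm : Measurable fun x : Plane => (2 * Real.pi) • x := by fun_prop
    refine ⟨hm, ?_⟩
    have := Measure.restrict_map (μ := (volume : Measure Plane)) hm
      (measurableSet_boxIoc (2 * Real.pi))
    rw [Measure.map_addHaar_smul _ hpos.ne', Measure.restrict_smul, ← cellMeasure_eq_Ioc] at this
    rw [finrank_euclideanSpace, Fintype.card_fin, abs_of_pos (by positivity)] at this
    rw [this]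
    congr 2
    ext x
    simp only [mem_ofPred_eq, mem_preimage, PiLp.smul_apply, smul_eq_mul, mem_Ioc]
    refine forall_congr' fun j => and_congr ?_ ?_
    · exact (mul_pos_iff_of_pos_left hpos).symm
    · exact (mul_le_iff_le_one_right hpos).symm
  exact h4.comp (h3.comp h2)

/-- The exponential `x ↦ e^{i k·x}`. -/
def expMode (k : Fin 2 → ℤ) (x : Plane) : ℂ :=
  Complex.exp (Complex.I * (inner ℝ (waveVec k) x : ℝ))

theorem inner_waveVec (k : Fin 2 → ℤ) (x : Plane) :
    inner ℝ (waveVec k) x = (k 0 : ℝ) * x 0 + k 1 * x 1 := by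
  simp [waveVec, PiLp.inner_apply, Fin.sum_univ_two, mul_comm]

theorem continuous_expMode (k : Fin 2 → ℤ) : Continuous (expMode k) := by
  unfold expMode
  have h : Continuous fun x : Plane => inner ℝ (waveVec k) x := continuous_const.inner continuous_id
  exact Complex.continuous_exp.comp (continuous_const.mul (Complex.continuous_ofReal.comp h))

theorem norm_expMode (k : Fin 2 → ℤ) (x : Plane) : ‖expMode k x‖ = 1 := by
  rw [expMode, mul_comm, Complex.norm_exp_ofReal_mul_I]

theorem memLp_expMode (p : ℝ≥0∞) (k : Fin 2 → ℤ) : MemLp (expMode k) p cellMeasure :=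
  MemLp.of_bound (continuous_expMode k).aestronglyMeasurable 1
    (ae_of_all _ fun x => (norm_expMode k x).le)

theorem expMode_torusLift (k : Fin 2 → ℤ) (y : UnitAddTorus (Fin 2)) :
    expMode k (torusLift y) = UnitAddTorus.mFourier k y := by
  have h : ∀ j, fourier (k j) (y j) =
      Complex.exp (2 * Real.pi * Complex.I * k j * (AddCircle.equivIoc 1 0 (y j)).1) := by
    intro j
    have := @fourier_coe_apply 1 (k j) (AddCircle.equivIoc 1 0 (y j)).1
    rw [AddCircle.coe_equivIoc] at this
    simpa using this
  simp only [UnitAddTorus.mFourier, ContinuousMap.coe_mk, Fin.prod_univ_two, h, ← Complex.exp_add,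
    expMode, inner_waveVec, torusLift, PiLp.smul_apply, smul_eq_mul]
  congr 1
  push_cast
  ring

theorem integral_torusLift {h : Plane → ℂ} (hh : AEStronglyMeasurable h cellMeasure) :
    ∫ y, h (torusLift y) = (((2 * Real.pi) ^ 2)⁻¹ : ℝ) • ∫ x, h x ∂cellMeasure := by
  have hp := measurePreserving_torusLift
  rw [← integral_map (f := h) hp.measurable.aemeasurable
    (by rw [hp.map_eq]; exact hh.smul_measure _), hp.map_eq, integral_smul_measure,
    ENNReal.toReal_ofReal (by positivity)]

/-- The normalized exponential `(2π)⁻¹ e^{i k·x}` as an element of `L²`. -/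
def modeLp (k : Fin 2 → ℤ) : Lp ℂ 2 cellMeasure :=
  ((2 * Real.pi)⁻¹ : ℂ) • (memLp_expMode 2 k).toLp

theorem coeFn_modeLp (k : Fin 2 → ℤ) :
    modeLp k =ᵐ[cellMeasure] fun x => ((2 * Real.pi)⁻¹ : ℂ) * expMode k x := by
  filter_upwards [Lp.coeFn_smul ((2 * Real.pi)⁻¹ : ℂ) (memLp_expMode 2 k).toLp,
    (memLp_expMode 2 k).coeFn_toLp] with x h1 h2
  rw [modeLp, h1, Pi.smul_apply, h2, smul_eq_mul]

theorem inner_modeLp (k : Fin 2 → ℤ) (f : Lp ℂ 2 cellMeasure) : inner ℂ (modeLp k) f =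
    ((2 * Real.pi)⁻¹ : ℂ) * ∫ x, starRingEnd ℂ (expMode k x) * f x ∂cellMeasure := by
  rw [L2.inner_def, ← integral_const_mul]
  refine integral_congr_ae ?_
  filter_upwards [coeFn_modeLp k] with x hx
  rw [RCLike.inner_apply, hx, map_mul]
  simp only [map_inv₀, map_mul, Complex.conj_ofReal, map_ofNat]
  ring

theorem orthonormal_modeLp : Orthonormal ℂ modeLp := by
  rw [orthonormal_iff_ite]
  intro k l
  have h0 := orthonormal_iff_ite.1 (UnitAddTorus.orthonormal_mFourier (d := Fin 2)) k l
  rw [← h0, inner_modeLp, ContinuousMap.inner_toLp]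
  simp only [← expMode_torusLift]
  rw [integral_torusLift (h := fun x => expMode l x * starRingEnd ℂ (expMode k x))
    (((continuous_expMode l).mul
      (Complex.continuous_conj.comp (continuous_expMode k))).aestronglyMeasurable)]
  have : ∫ x, starRingEnd ℂ (expMode k x) * modeLp l x ∂cellMeasure =
      ((2 * Real.pi)⁻¹ : ℂ) * ∫ x, expMode l x * starRingEnd ℂ (expMode k x) ∂cellMeasure := by
    rw [← integral_const_mul]
    refine integral_congr_ae ?_
    filter_upwards [coeFn_modeLp l] with x hx
    rw [hx]; ring
  rw [this, Complex.real_smul, ← mul_assoc]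
  congr 1
  push_cast
  rw [← mul_inv, sq]

/-- Completeness of the exponentials is inherited from the torus: all Fourier coefficients of `f ∘
torusLift` vanish, so its `L²` Fourier series sums to zero. Null sets are then carried back through
`torusLift`. -/
theorem eq_zero_of_inner_modeLp (f : Lp ℂ 2 cellMeasure) (h : ∀ k, inner ℂ (modeLp k) f = 0) :
    f = 0 := by
  have hp := measurePreserving_torusLift
  have hc : ENNReal.ofReal ((2 * Real.pi) ^ 2)⁻¹ ≠ 0 := by
    simp only [ne_eq, ENNReal.ofReal_eq_zero, not_le]; positivity
  have hg : MemLp (fun y => f (torusLift y)) 2 (volume : Measure (UnitAddTorus (Fin 2))) :=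
    ((Lp.memLp f).smul_measure ENNReal.ofReal_ne_top).comp_measurePreserving hp
  have hcoef : ∀ k, UnitAddTorus.mFourierCoeff (hg.toLp) k = 0 := by
    intro k
    have h1 : UnitAddTorus.mFourierCoeff (hg.toLp) k =
        ∫ y, starRingEnd ℂ (expMode k (torusLift y)) * f (torusLift y) := by
      refine integral_congr_ae ?_
      filter_upwards [hg.coeFn_toLp] with y hy
      rw [hy, UnitAddTorus.mFourier_neg, expMode_torusLift, smul_eq_mul]
    rw [h1, integral_torusLift (h := fun x => starRingEnd ℂ (expMode k x) * f x)
      ((Complex.continuous_conj.comp (continuous_expMode k)).aestronglyMeasurable.mul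
        (Lp.memLp f).aestronglyMeasurable)]
    have h2 := h k
    rw [inner_modeLp] at h2
    have h3 : ((2 * Real.pi)⁻¹ : ℂ) ≠ 0 := by
      simp [Real.pi_ne_zero]
    rw [(mul_eq_zero.1 h2).resolve_left h3, smul_zero]
  have hz : hg.toLp = 0 := by
    have h1 := UnitAddTorus.hasSum_mFourier_series_L2 hg.toLp
    simp only [hcoef, zero_smul] at h1
    exact h1.unique hasSum_zero
  have hz' : ∀ᵐ y : UnitAddTorus (Fin 2), f (torusLift y) = 0 := by
    filter_upwards [hg.coeFn_toLp, Lp.coeFn_zero ℂ 2 (volume : Measure (UnitAddTorus (Fin 2)))]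
      with y h1 h2
    rw [← h1, hz, h2]; rfl
  rw [Lp.eq_zero_iff_ae_eq_zero]
  have h5 : ∀ᵐ x ∂(ENNReal.ofReal ((2 * Real.pi) ^ 2)⁻¹ • cellMeasure), f x = 0 := by
    rw [← hp.map_eq]
    exact (ae_map_iff hp.measurable.aemeasurable
      ((Lp.stronglyMeasurable f).measurable (measurableSet_singleton 0))).2 hz'
  exact (Measure.ae_ennreal_smul_measure_iff hc).1 h5

/-- The Hilbert basis of normalized exponentials. -/
def modeBasis : HilbertBasis (Fin 2 → ℤ) ℂ (Lp ℂ 2 cellMeasure) :=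
  HilbertBasis.mkOfOrthogonalEqBot orthonormal_modeLp (by
    rw [Submodule.eq_bot_iff]
    intro f hf
    exact eq_zero_of_inner_modeLp f fun k =>
      (Submodule.mem_orthogonal _ f).1 hf _ (Submodule.subset_span (mem_range_self k)))

theorem coe_modeBasis : ⇑modeBasis = modeLp := HilbertBasis.coe_mkOfOrthogonalEqBot _ _

/-! ### A one-dimensional slicing inequality -/

theorem integrable_of_continuous {E : Type*} [NormedAddCommGroup E] {h : Plane → E}
    (hh : Continuous h) : Integrable h cellMeasure := by
  obtain ⟨C, hC⟩ := isBounded_cell.isCompact_closure.exists_bound_of_continuousOn hh.continuousOn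
  exact Integrable.of_bound hh.aestronglyMeasurable C
    ((ae_restrict_mem measurableSet_cell).mono fun x hx => hC x (subset_closure hx))

/-- The value at `x` exceeds the value at any other point `s` by at most the total variation;
averaging over `s` gives the bound. Mean and variation are kept under one integral so that it can
serve as a slice in Fubini's theorem. -/
theorem le_average_add_integral_deriv {L : ℝ} (hL : 0 < L) {g g' : ℝ → ℝ}
    (hg : ∀ s, HasDerivAt g (g' s) s) (hg' : Continuous g') {x : ℝ} (hx : x ∈ Icc 0 L) :
    g x ≤ ∫ s in Ioo 0 L, (L⁻¹ * g s + |g' s|) := by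
  have hgc : Continuous g := continuous_iff_continuousAt.2 fun s => (hg s).continuousAt
  have key : ∀ s ∈ Icc 0 L, g x - g s ≤ ∫ r in (0)..L, |g' r| := by
    intro s hs
    rw [← intervalIntegral.integral_eq_sub_of_hasDerivAt (fun r _ => hg r)
      (hg'.intervalIntegrable s x)]
    refine (Real.le_norm_self _).trans
      ((intervalIntegral.norm_integral_le_integral_norm_uIoc).trans ?_)
    simp only [Real.norm_eq_abs]
    rw [intervalIntegral.integral_of_le hL.le]
    refine setIntegral_mono_set ?_ (ae_of_all _ fun _ => abs_nonneg _) ?_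
    · exact (hg'.abs.intervalIntegrable 0 L).1
    · refine LE.le.eventuallyLE ?_
      rw [uIoc]
      exact Ioc_subset_Ioc (le_min hs.1 hx.1) (max_le hs.2 hx.2)
  have h1 : ∫ s in (0)..L, g x ≤ ∫ s in (0)..L, (g s + ∫ r in (0)..L, |g' r|) :=
    intervalIntegral.integral_mono_on hL.le (by simp)
      ((hgc.add continuous_const).intervalIntegrable _ _) fun s hs => by linarith [key s hs]
  rw [intervalIntegral.integral_add (hgc.intervalIntegrable _ _) (by simp)] at h1
  simp only [intervalIntegral.integral_const, sub_zero, smul_eq_mul] at h1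
  rw [← integral_Ioc_eq_integral_Ioo, ← intervalIntegral.integral_of_le hL.le,
    intervalIntegral.integral_add ((hgc.const_mul _).intervalIntegrable _ _)
      (hg'.abs.intervalIntegrable _ _), intervalIntegral.integral_const_mul]
  have : L * g x ≤ L * (L⁻¹ * (∫ s in (0)..L, g s) + ∫ r in (0)..L, |g' r|) := by
    rw [mul_add, mul_inv_cancel_left₀ hL.ne']; exact h1
  exact le_of_mul_le_mul_left this hL

/-- The point of the plane with given coordinates. -/
def planePoint (p : ℝ × ℝ) : Plane :=
  p.1 • EuclideanSpace.single 0 1 + p.2 • EuclideanSpace.single 1 1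

theorem planePoint_eq (p : ℝ × ℝ) : planePoint p = WithLp.toLp 2 ![p.1, p.2] := by
  ext j
  fin_cases j <;> simp [planePoint]

theorem continuous_planePoint : Continuous planePoint := by unfold planePoint; fun_prop

/-- Lebesgue measure on the interval `(0, 2π)`. -/
abbrev sideMeasure : Measure ℝ := volume.restrict (Ioo 0 (2 * Real.pi))

theorem measurePreserving_planePoint :
    MeasurePreserving planePoint (sideMeasure.prod sideMeasure) cellMeasure := by
  have h := ((PiLp.volume_preserving_toLp (Fin 2)).comp
    (volume_preserving_finTwoArrow ℝ).symm).restrict_preimage measurableSet_cell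
  rw [← cellMeasure] at h
  have he : (WithLp.toLp 2 ∘ (MeasurableEquiv.finTwoArrow (α := ℝ)).symm) = planePoint := by
    funext p
    rw [planePoint_eq]
    simp [MeasurableEquiv.finTwoArrow]
  rw [he] at h
  have hs : planePoint ⁻¹' cell = Ioo 0 (2 * Real.pi) ×ˢ Ioo 0 (2 * Real.pi) := by
    ext p
    simp [planePoint_eq, cell, Fin.forall_fin_two]
  rw [hs, Measure.volume_eq_prod, ← Measure.prod_restrict] at h
  exact h

theorem hasDerivAt_planePoint_fst {G : Plane → ℝ} (hG : Differentiable ℝ G) (s b : ℝ) :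
    HasDerivAt (fun s => G (planePoint (s, b))) (partialDeriv 0 G (planePoint (s, b))) s := by
  have h : HasDerivAt (fun s : ℝ => planePoint (s, b)) (EuclideanSpace.single 0 1) s := by
    simpa [planePoint] using ((hasDerivAt_id s).smul_const
      (EuclideanSpace.single (0 : Fin 2) (1 : ℝ))).add_const
      (b • EuclideanSpace.single (1 : Fin 2) (1 : ℝ))
  exact (hG _).hasFDerivAt.comp_hasDerivAt s h

theorem hasDerivAt_planePoint_snd {G : Plane → ℝ} (hG : Differentiable ℝ G) (a s : ℝ) :
    HasDerivAt (fun s => G (planePoint (a, s))) (partialDeriv 1 G (planePoint (a, s))) s := by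
  have h : HasDerivAt (fun s : ℝ => planePoint (a, s)) (EuclideanSpace.single 1 1) s := by
    simpa [planePoint] using ((hasDerivAt_id s).smul_const
      (EuclideanSpace.single (1 : Fin 2) (1 : ℝ))).const_add
      (a • EuclideanSpace.single (0 : Fin 2) (1 : ℝ))
  exact (hG _).hasFDerivAt.comp_hasDerivAt s h

theorem continuous_partialDeriv_of_contDiff {G : Plane → ℝ} (hG : ContDiff ℝ 1 G) (j : Fin 2) :
    Continuous (partialDeriv j G) :=
  (hG.continuous_fderiv (by simp)).clm_apply continuous_const

/-- The Gagliardo-Nirenberg inequality on the period cell for nonnegative `C¹` functions. -/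
theorem integral_sq_le_mul {G : Plane → ℝ} (hG : ContDiff ℝ 1 G) (h0 : ∀ x, 0 ≤ G x) :
    ∫ x, G x ^ 2 ∂cellMeasure ≤
      (∫ x, ((2 * Real.pi)⁻¹ * G x + |partialDeriv 0 G x|) ∂cellMeasure) *
      ∫ x, ((2 * Real.pi)⁻¹ * G x + |partialDeriv 1 G x|) ∂cellMeasure := by
  have hL : (0 : ℝ) < 2 * Real.pi := by positivity
  have hmp := measurePreserving_planePoint
  have hd : Differentiable ℝ G := hG.differentiable (by simp)
  set K : Fin 2 → Plane → ℝ := fun j x => (2 * Real.pi)⁻¹ * G x + |partialDeriv j G x| with hK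
  have hKc : ∀ j, Continuous (K j) := fun j =>
    (hG.continuous.const_mul _).add (continuous_partialDeriv_of_contDiff hG j).abs
  have hint : ∀ {h : Plane → ℝ}, Continuous h →
      Integrable (fun p => h (planePoint p)) (sideMeasure.prod sideMeasure) := fun hh =>
    hmp.integrable_comp_of_integrable (integrable_of_continuous hh)
  have htr : ∀ {h : Plane → ℝ}, Continuous h →
      ∫ x, h x ∂cellMeasure = ∫ p, h (planePoint p) ∂(sideMeasure.prod sideMeasure) := by
    intro h hh
    rw [← hmp.map_eq, integral_map hmp.measurable.aemeasurable
      (hh.aestronglyMeasurable)]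
  have e0 : ∫ x, K 0 x ∂cellMeasure =
      ∫ b, (∫ s, K 0 (planePoint (s, b)) ∂sideMeasure) ∂sideMeasure := by
    rw [htr (hKc 0), integral_prod_symm _ (hint (hKc 0))]
  have e1 : ∫ x, K 1 x ∂cellMeasure =
      ∫ a, (∫ s, K 1 (planePoint (a, s)) ∂sideMeasure) ∂sideMeasure := by
    rw [htr (hKc 1), integral_prod _ (hint (hKc 1))]
  have i0 : Integrable (fun b => ∫ s, K 0 (planePoint (s, b)) ∂sideMeasure) sideMeasure :=
    (hint (hKc 0)).integral_prod_right
  have i1 : Integrable (fun a => ∫ s, K 1 (planePoint (a, s)) ∂sideMeasure) sideMeasure :=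
    (hint (hKc 1)).integral_prod_left
  change _ ≤ (∫ x, K 0 x ∂cellMeasure) * ∫ x, K 1 x ∂cellMeasure
  -- One factor of `G` is bounded by the horizontal slice integral, which depends only on the second
  -- coordinate, and the other by the vertical one, which depends only on the first. The double
  -- integral of the product therefore factorises.
  rw [htr (h := fun x => G x ^ 2) (hG.continuous.pow 2), e0, e1, mul_comm, ← integral_prod_mul]
  refine integral_mono_ae (hint (h := fun x => G x ^ 2) (hG.continuous.pow 2)) (i1.mul_prod i0) ?_
  have hmem : ∀ᵐ p ∂(sideMeasure.prod sideMeasure),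
      p ∈ Ioo 0 (2 * Real.pi) ×ˢ Ioo 0 (2 * Real.pi) := by
    rw [Measure.prod_restrict]
    exact ae_restrict_mem (measurableSet_Ioo.prod measurableSet_Ioo)
  filter_upwards [hmem] with p hp
  have hs0 := le_average_add_integral_deriv hL (fun s => hasDerivAt_planePoint_fst hd s p.2)
    ((continuous_partialDeriv_of_contDiff hG 0).comp
      (continuous_planePoint.comp (by fun_prop : Continuous fun s : ℝ => (s, p.2))))
    (Ioo_subset_Icc_self hp.1)
  have hs1 := le_average_add_integral_deriv hL (fun s => hasDerivAt_planePoint_snd hd p.1 s)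
    ((continuous_partialDeriv_of_contDiff hG 1).comp
      (continuous_planePoint.comp (by fun_prop : Continuous fun s : ℝ => (p.1, s))))
    (Ioo_subset_Icc_self hp.2)
  rw [sq]
  exact mul_le_mul hs1 hs0 (h0 _) ((h0 _).trans hs1)

/-! ### Trigonometric sums -/

/-- The trigonometric sum `∑_{k ∈ s} c_k (2π)⁻¹ e^{i k·x}`. -/
def trigSum (s : Finset (Fin 2 → ℤ)) (c : (Fin 2 → ℤ) → ℂ) (x : Plane) : ℂ :=
  ∑ k ∈ s, c k * (((2 * Real.pi)⁻¹ : ℂ) * expMode k x)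

/-- The coefficients of the partial derivative of a trigonometric sum. -/
def derivCoeff (j : Fin 2) (c : (Fin 2 → ℤ) → ℂ) (k : Fin 2 → ℤ) : ℂ := Complex.I * k j * c k

theorem contDiff_expMode (k : Fin 2 → ℤ) : ContDiff ℝ ∞ (expMode k) := by
  unfold expMode
  have h : ContDiff ℝ ∞ fun x : Plane => inner ℝ (waveVec k) x := contDiff_const.inner ℝ contDiff_id
  exact (contDiff_const.mul (Complex.ofRealCLM.contDiff.comp h)).cexp

theorem contDiff_trigSum (s : Finset (Fin 2 → ℤ)) (c : (Fin 2 → ℤ) → ℂ) :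
    ContDiff ℝ ∞ (trigSum s c) :=
  ContDiff.sum fun k _ => contDiff_const.mul (contDiff_const.mul (contDiff_expMode k))

theorem fderiv_expMode (k : Fin 2 → ℤ) (x : Plane) (j : Fin 2) :
    fderiv ℝ (expMode k) x (EuclideanSpace.single j 1) = Complex.I * k j * expMode k x := by
  have h1 : HasFDerivAt (fun x : Plane => inner ℝ (waveVec k) x) (innerSL ℝ (waveVec k)) x :=
    (innerSL ℝ (waveVec k)).hasFDerivAt
  have h2 := ((Complex.ofRealCLM.hasFDerivAt.comp x h1).const_mul Complex.I).cexp
  have h3 : HasFDerivAt (expMode k) _ x := h2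
  rw [h3.fderiv]
  have h4 : inner ℝ (waveVec k) (EuclideanSpace.single j (1 : ℝ)) = (k j : ℝ) := by
    rw [inner_waveVec]
    fin_cases j <;> simp
  simp only [smul_apply, ContinuousLinearMap.comp_apply, innerSL_apply_apply,
    Function.comp_apply, h4, Complex.ofRealCLM_apply, expMode, smul_eq_mul]
  push_cast
  ring

theorem fderiv_trigSum (s : Finset (Fin 2 → ℤ)) (c : (Fin 2 → ℤ) → ℂ) (x : Plane) (j : Fin 2) :
    fderiv ℝ (trigSum s c) x (EuclideanSpace.single j 1) = trigSum s (derivCoeff j c) x := by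
  have hd : ∀ k ∈ s, HasFDerivAt (fun x => c k * (((2 * Real.pi)⁻¹ : ℂ) * expMode k x))
      (c k • (((2 * Real.pi)⁻¹ : ℂ) • fderiv ℝ (expMode k) x)) x := fun k _ =>
    ((((contDiff_expMode k).differentiable (by simp)) x).hasFDerivAt.const_mul _).const_mul _
  have h : HasFDerivAt (trigSum s c) _ x := HasFDerivAt.fun_sum hd
  rw [h.fderiv, sum_apply, trigSum]
  refine Finset.sum_congr rfl fun k _ => ?_
  simp only [smul_apply, fderiv_expMode, smul_eq_mul, derivCoeff]
  ring

theorem expMode_periodic (k : Fin 2 → ℤ) (j : Fin 2) (x : Plane) :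
    expMode k (x + EuclideanSpace.single j (2 * Real.pi)) = expMode k x := by
  have h : inner ℝ (waveVec k) (EuclideanSpace.single j (2 * Real.pi) : Plane) =
      k j * (2 * Real.pi) := by
    rw [inner_waveVec]
    fin_cases j <;> simp
  rw [expMode, inner_add_right, h, Complex.ofReal_add, mul_add, Complex.exp_add, expMode]
  have : Complex.exp (Complex.I * ((k j * (2 * Real.pi) : ℝ) : ℂ)) = 1 := by
    rw [Complex.exp_eq_one_iff]
    exact ⟨k j, by push_cast; ring⟩
  rw [this, mul_one]

theorem isTest_norm_sq_trigSum (s : Finset (Fin 2 → ℤ)) (c : (Fin 2 → ℤ) → ℂ) :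
    IsTest fun x => ‖trigSum s c x‖ ^ 2 :=
  ⟨(contDiff_trigSum s c).norm_sq ℝ, fun j x => by simp only [trigSum, expMode_periodic]⟩

theorem partialDeriv_norm_sq_trigSum (s : Finset (Fin 2 → ℤ)) (c : (Fin 2 → ℤ) → ℂ) (j : Fin 2)
    (x : Plane) : partialDeriv j (fun x => ‖trigSum s c x‖ ^ 2) x =
      2 * (starRingEnd ℂ (trigSum s c x) * trigSum s (derivCoeff j c) x).re := by
  have h := ((((contDiff_trigSum s c).differentiable (by simp)) x).hasFDerivAt).norm_sq
  rw [partialDeriv, h.fderiv]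
  simp only [smul_apply, ContinuousLinearMap.comp_apply, innerSL_apply_apply,
    fderiv_trigSum, Complex.inner, nsmul_eq_mul]
  simp [mul_comm]

/-! ### Fourier derivatives -/

/-- The Fourier coefficients of `g` are those of the partial derivative `∂_j f`. -/
def IsFourierDeriv (j : Fin 2) (f g : Lp ℂ 2 cellMeasure) : Prop :=
  ∀ k, inner ℂ (modeLp k) g = Complex.I * k j * inner ℂ (modeLp k) f

/-- The partial sums of the Fourier series. -/
def partialSum (s : Finset (Fin 2 → ℤ)) (f : Lp ℂ 2 cellMeasure) : Lp ℂ 2 cellMeasure :=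
  ∑ k ∈ s, inner ℂ (modeLp k) f • modeLp k

theorem tendsto_partialSum (f : Lp ℂ 2 cellMeasure) :
    Tendsto (fun s => partialSum s f) atTop (𝓝 f) := by
  have h := modeBasis.hasSum_repr f
  simp only [modeBasis.repr_apply_apply, coe_modeBasis] at h
  exact h

theorem coeFn_partialSum (s : Finset (Fin 2 → ℤ)) (f : Lp ℂ 2 cellMeasure) :
    partialSum s f =ᵐ[cellMeasure] trigSum s fun k => inner ℂ (modeLp k) f := by
  classical
  unfold partialSum
  induction s using Finset.induction_on with
  | empty =>
    filter_upwards [Lp.coeFn_zero ℂ 2 cellMeasure] with x hx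
    simpa [trigSum] using hx
  | insert k s hk ih =>
    rw [Finset.sum_insert hk]
    filter_upwards [ih, Lp.coeFn_add (inner ℂ (modeLp k) f • modeLp k)
      (∑ k ∈ s, inner ℂ (modeLp k) f • modeLp k), Lp.coeFn_smul (inner ℂ (modeLp k) f) (modeLp k),
      coeFn_modeLp k] with x h1 h2 h3 h4
    rw [h2, Pi.add_apply, h1, h3, Pi.smul_apply, h4, trigSum, trigSum, Finset.sum_insert hk,
      smul_eq_mul]

theorem IsFourierDeriv.coeFn_partialSum {j : Fin 2} {f g : Lp ℂ 2 cellMeasure}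
    (h : IsFourierDeriv j f g) (s : Finset (Fin 2 → ℤ)) :
    partialSum s g =ᵐ[cellMeasure] trigSum s (derivCoeff j fun k => inner ℂ (modeLp k) f) := by
  filter_upwards [NSE.coeFn_partialSum s g] with x hx
  rw [hx]
  exact Finset.sum_congr rfl fun k _ => by simp only [derivCoeff, h k]

theorem inner_modeLp_partialSum (s : Finset (Fin 2 → ℤ)) (f : Lp ℂ 2 cellMeasure)
    (k : Fin 2 → ℤ) [Decidable (k ∈ s)] : inner ℂ (modeLp k) (partialSum s f) =
      if k ∈ s then inner ℂ (modeLp k) f else 0 := by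
  classical
  simp only [partialSum, inner_sum, inner_smul_right, orthonormal_iff_ite.1 orthonormal_modeLp]
  simp

/-- Truncation acts diagonally on coefficients and so commutes with differentiation. This makes the
`L⁴` estimates available for the tails of the series. -/
theorem IsFourierDeriv.partialSum_sub {j : Fin 2} {f g : Lp ℂ 2 cellMeasure}
    (h : IsFourierDeriv j f g) (s : Finset (Fin 2 → ℤ)) :
    IsFourierDeriv j (partialSum s f - f) (partialSum s g - g) := by
  classical
  intro k
  rw [inner_sub_right, inner_sub_right, inner_modeLp_partialSum, inner_modeLp_partialSum, h k]
  split_ifs <;> ring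

theorem hasSum_norm_inner_modeLp_sq (f : Lp ℂ 2 cellMeasure) :
    HasSum (fun k => ‖inner ℂ (modeLp k) f‖ ^ 2) (‖f‖ ^ 2) := by
  have h := RCLike.hasSum_re ℂ (modeBasis.hasSum_inner_mul_inner f f)
  rw [inner_self_eq_norm_sq] at h
  refine h.congr_fun fun k => ?_
  rw [coe_modeBasis, ← inner_conj_symm f (modeLp k), RCLike.conj_mul]
  norm_cast

/-- Integration by parts. -/
theorem IsFourierDeriv.inner_eq {j : Fin 2} {a b c d : Lp ℂ 2 cellMeasure}
    (h : IsFourierDeriv j a b) (h' : IsFourierDeriv j c d) : inner ℂ b c = - inner ℂ a d := by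
  have h1 := modeBasis.hasSum_inner_mul_inner b c
  have h2 := (modeBasis.hasSum_inner_mul_inner a d).neg
  refine h1.unique (h2.congr_fun fun k => ?_)
  rw [coe_modeBasis, ← inner_conj_symm b, ← inner_conj_symm a, h k, h' k]
  simp only [map_mul, Complex.conj_I, map_intCast]
  ring

/-- A spectral gap inequality. -/
theorem IsFourierDeriv.mul_norm_sq_le {f q : Lp ℂ 2 cellMeasure} {g : Fin 2 → Lp ℂ 2 cellMeasure}
    (h : ∀ j, IsFourierDeriv j f (g j)) {R : ℝ}
    (hR : ∀ k, R * ‖inner ℂ (modeLp k) q‖ ^ 2 ≤ ‖waveVec k‖ ^ 2 * ‖inner ℂ (modeLp k) f‖ ^ 2) :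
    R * ‖q‖ ^ 2 ≤ ∑ j, ‖g j‖ ^ 2 := by
  refine hasSum_le ?_ ((hasSum_norm_inner_modeLp_sq q).mul_left R)
    (hasSum_sum fun j _ => hasSum_norm_inner_modeLp_sq (g j))
  intro k
  refine (hR k).trans (le_of_eq ?_)
  simp only [h _ k, norm_mul, Complex.norm_I, one_mul, mul_pow, ← Finset.sum_mul]
  congr 1
  rw [EuclideanSpace.norm_sq_eq]
  simp [waveVec]

/-! ### Ladyzhenskaya's inequality -/

instance : ENNReal.HolderTriple 4 4 2 := ⟨by
  have h : (4 : ℝ≥0∞) = 2 * 2 := by norm_num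
  rw [h, ENNReal.mul_inv (by norm_num) (by norm_num), ← mul_add, ENNReal.inv_two_add_inv_two,
    mul_one]⟩

/-- The `L⁴` norm on the period cell. -/
def normL4 (f : Plane → ℂ) : ℝ := (eLpNorm f 4 cellMeasure).toReal

theorem normL4_nonneg (f : Plane → ℂ) : 0 ≤ normL4 f := ENNReal.toReal_nonneg

theorem integral_norm_mul_norm_le (f g : Lp ℂ 2 cellMeasure) :
    ∫ x, ‖f x‖ * ‖g x‖ ∂cellMeasure ≤ ‖f‖ * ‖g‖ := by
  have h := integral_mul_norm_le_Lp_mul_Lq (p := 2) (q := 2) (μ := cellMeasure) (f := f) (g := g)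
    Real.HolderConjugate.two_two (by simpa using Lp.memLp f) (by simpa using Lp.memLp g)
  have e : ∀ f : Lp ℂ 2 cellMeasure, (∫ x, ‖f x‖ ^ (2 : ℝ) ∂cellMeasure) ^ (1 / 2 : ℝ) = ‖f‖ := by
    intro f
    rw [Lp.norm_def, (Lp.memLp f).eLpNorm_eq_integral_rpow_norm (by norm_num) (by norm_num),
      ENNReal.toReal_ofReal (by positivity)]
    norm_num
  rwa [e, e] at h

/-- The factor `(2π)⁻¹ |f|² + 2 |f| |g|` in the Gagliardo-Nirenberg inequality. -/
def sliceBound (f g : Lp ℂ 2 cellMeasure) : ℝ := (2 * Real.pi)⁻¹ * ‖f‖ ^ 2 + 2 * (‖f‖ * ‖g‖)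

theorem sliceBound_nonneg (f g : Lp ℂ 2 cellMeasure) : 0 ≤ sliceBound f g := by
  unfold sliceBound; positivity

/-- For a trigonometric sum `T`, `|∂_j |T|²| ≤ 2 |T| |∂_j T|`; Cauchy–Schwarz does the rest. -/
theorem integral_slice_le {j : Fin 2} {f g : Lp ℂ 2 cellMeasure} (h : IsFourierDeriv j f g)
    (s : Finset (Fin 2 → ℤ)) :
    ∫ x, ((2 * Real.pi)⁻¹ * ‖trigSum s (fun k => inner ℂ (modeLp k) f) x‖ ^ 2 +
      |partialDeriv j (fun x => ‖trigSum s (fun k => inner ℂ (modeLp k) f) x‖ ^ 2) x|)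
      ∂cellMeasure ≤
    sliceBound (partialSum s f) (partialSum s g) := by
  have hI : Integrable (fun x => ‖(partialSum s f) x‖ * ‖(partialSum s g) x‖) cellMeasure :=
    (Lp.memLp (partialSum s f)).norm.integrable_mul (Lp.memLp (partialSum s g)).norm
  have hI2 : Integrable (fun x => ‖(partialSum s f) x‖ ^ 2) cellMeasure := by
    simp only [sq]
    exact (Lp.memLp (partialSum s f)).norm.integrable_mul (Lp.memLp (partialSum s f)).norm
  have hle : ∫ x, ((2 * Real.pi)⁻¹ * ‖trigSum s (fun k => inner ℂ (modeLp k) f) x‖ ^ 2 +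
      |partialDeriv j (fun x => ‖trigSum s (fun k => inner ℂ (modeLp k) f) x‖ ^ 2) x|)
      ∂cellMeasure ≤
      ∫ x, ((2 * Real.pi)⁻¹ * ‖(partialSum s f) x‖ ^ 2 +
        2 * (‖(partialSum s f) x‖ * ‖(partialSum s g) x‖)) ∂cellMeasure := by
    refine integral_mono_ae (integrable_of_continuous ?_)
      ((hI2.const_mul _).add (hI.const_mul 2)) ?_
    · exact (((contDiff_trigSum s _).continuous.norm.pow 2).const_mul _).add
        (continuous_partialDeriv (isTest_norm_sq_trigSum s _) j).abs
    · filter_upwards [coeFn_partialSum s f, h.coeFn_partialSum s] with x h1 h2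
      rw [h1, h2, partialDeriv_norm_sq_trigSum, abs_mul, abs_two]
      gcongr
      refine (Complex.abs_re_le_norm _).trans ?_
      rw [norm_mul, RCLike.norm_conj]
  refine hle.trans ?_
  rw [integral_add (hI2.const_mul _) (hI.const_mul 2), integral_const_mul, integral_const_mul,
    sliceBound]
  have h1 := integral_norm_mul_norm_le (partialSum s f) (partialSum s f)
  have h2 := integral_norm_mul_norm_le (partialSum s f) (partialSum s g)
  simp only [← sq] at h1
  gcongr

/-- This is the Gagliardo–Nirenberg inequality applied to the smooth function `|T|²`, whose `L²`
norm squared is the fourth power of the `L⁴` norm of `T`. -/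
theorem eLpNorm_partialSum_le {f : Lp ℂ 2 cellMeasure} {g : Fin 2 → Lp ℂ 2 cellMeasure}
    (h : ∀ j, IsFourierDeriv j f (g j)) (s : Finset (Fin 2 → ℤ)) :
    eLpNorm (partialSum s f) 4 cellMeasure ≤ ENNReal.ofReal
      ((sliceBound (partialSum s f) (partialSum s (g 0)) *
        sliceBound (partialSum s f) (partialSum s (g 1))) ^ (4⁻¹ : ℝ)) := by
  set T := trigSum s (fun k => inner ℂ (modeLp k) f) with hT
  have hTc : Continuous T := (contDiff_trigSum s _).continuous
  have hTm : MemLp T 4 cellMeasure := by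
    obtain ⟨C, hC⟩ := isBounded_cell.isCompact_closure.exists_bound_of_continuousOn hTc.continuousOn
    exact MemLp.of_bound hTc.aestronglyMeasurable C
      ((ae_restrict_mem measurableSet_cell).mono fun x hx => hC x (subset_closure hx))
  rw [eLpNorm_congr_ae (coeFn_partialSum s f),
    hTm.eLpNorm_eq_integral_rpow_norm (by norm_num) (by norm_num)]
  refine ENNReal.ofReal_le_ofReal ?_
  have h4 : (4 : ℝ≥0∞).toReal = 4 := by norm_num
  rw [h4]
  refine Real.rpow_le_rpow (by positivity) ?_ (by positivity)
  have h1 := integral_sq_le_mul (G := fun x => ‖T x‖ ^ 2)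
    ((isTest_norm_sq_trigSum s _).1.of_le (by norm_cast)) fun x => by positivity
  have h2 : ∫ x, ‖T x‖ ^ (4 : ℝ) ∂cellMeasure = ∫ x, (‖T x‖ ^ 2) ^ 2 ∂cellMeasure := by
    refine integral_congr_ae (ae_of_all _ fun x => ?_)
    change ‖T x‖ ^ (4 : ℝ) = (‖T x‖ ^ 2) ^ 2
    rw [← pow_mul]
    exact_mod_cast Real.rpow_natCast ‖T x‖ 4
  rw [h2]
  refine h1.trans (mul_le_mul (integral_slice_le (h 0) s) (integral_slice_le (h 1) s) ?_
    (sliceBound_nonneg _ _))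
  exact integral_nonneg fun x => by positivity

/-- Partial sums converge in `L²`, hence almost everywhere along a sequence of finite sets. Fatou's
lemma passes the `L⁴` bound to the limit, and the bounds converge because `sliceBound` involves only
`L²` norms. -/
theorem eLpNorm_four_le {f : Lp ℂ 2 cellMeasure} {g : Fin 2 → Lp ℂ 2 cellMeasure}
    (h : ∀ j, IsFourierDeriv j f (g j)) :
    eLpNorm f 4 cellMeasure ≤ ENNReal.ofReal
      ((sliceBound f (g 0) * sliceBound f (g 1)) ^ (4⁻¹ : ℝ)) := by
  obtain ⟨ns, hns, hae⟩ :=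
    (tendstoInMeasure_of_tendsto_Lp (tendsto_partialSum f)).exists_seq_tendsto_ae'
  have h1 := Lp.eLpNorm_lim_le_liminf_eLpNorm (p := 4)
    (f := fun n => (partialSum (ns n) f : Plane → ℂ))
    (fun n => (Lp.memLp _).aestronglyMeasurable) f hae
  have hb : ∀ j, Tendsto (fun s => sliceBound (partialSum s f) (partialSum s (g j))) atTop
      (𝓝 (sliceBound f (g j))) := fun j =>
    (((tendsto_partialSum f).norm.pow 2).const_mul _).add
      (((tendsto_partialSum f).norm.mul (tendsto_partialSum (g j)).norm).const_mul 2)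
  have h2 : Tendsto (fun s => ENNReal.ofReal
      ((sliceBound (partialSum s f) (partialSum s (g 0)) *
        sliceBound (partialSum s f) (partialSum s (g 1))) ^ (4⁻¹ : ℝ))) atTop
      (𝓝 (ENNReal.ofReal ((sliceBound f (g 0) * sliceBound f (g 1)) ^ (4⁻¹ : ℝ)))) :=
    ENNReal.tendsto_ofReal (((hb 0).mul (hb 1)).rpow_const (Or.inr (by norm_num)))
  refine h1.trans ?_
  rw [← (h2.comp hns).liminf_eq]
  exact liminf_le_liminf (Eventually.of_forall fun n => eLpNorm_partialSum_le h (ns n))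

theorem memLp_four {f : Lp ℂ 2 cellMeasure} {g : Fin 2 → Lp ℂ 2 cellMeasure}
    (h : ∀ j, IsFourierDeriv j f (g j)) : MemLp f 4 cellMeasure :=
  ⟨(Lp.memLp f).aestronglyMeasurable, (eLpNorm_four_le h).trans_lt ENNReal.ofReal_lt_top⟩

theorem normL4_le {f : Lp ℂ 2 cellMeasure} {g : Fin 2 → Lp ℂ 2 cellMeasure}
    (h : ∀ j, IsFourierDeriv j f (g j)) :
    normL4 f ≤ (sliceBound f (g 0) * sliceBound f (g 1)) ^ (4⁻¹ : ℝ) :=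
  ENNReal.toReal_le_of_le_ofReal (Real.rpow_nonneg
    (mul_nonneg (sliceBound_nonneg _ _) (sliceBound_nonneg _ _)) _) (eLpNorm_four_le h)

theorem one_le_norm_waveVec_sq {k : Fin 2 → ℤ} (hk : k ≠ 0) : 1 ≤ ‖waveVec k‖ ^ 2 := by
  obtain ⟨j, hj⟩ := Function.ne_iff.1 hk
  have h1 : (1 : ℝ) ≤ (k j : ℝ) ^ 2 := by
    have : 0 < (k j) ^ 2 := by have : k j ≠ 0 := hj; positivity
    exact_mod_cast this
  rw [EuclideanSpace.norm_sq_eq]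
  refine h1.trans ?_
  have : ∀ i, 0 ≤ ‖waveVec k i‖ ^ 2 := fun i => by positivity
  refine le_trans ?_ (Finset.single_le_sum (fun i _ => this i) (Finset.mem_univ j))
  simp [waveVec]

/-- The Poincaré inequality. -/
theorem norm_sq_le_of_isFourierDeriv {f : Lp ℂ 2 cellMeasure} {g : Fin 2 → Lp ℂ 2 cellMeasure}
    (h : ∀ j, IsFourierDeriv j f (g j)) (h0 : inner ℂ (modeLp 0) f = 0) :
    ‖f‖ ^ 2 ≤ ∑ j, ‖g j‖ ^ 2 := by
  have := IsFourierDeriv.mul_norm_sq_le (R := 1) (q := f) h fun k => by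
    by_cases hk : k = 0
    · rw [hk, h0]; simp
    · exact mul_le_mul_of_nonneg_right (one_le_norm_waveVec_sq hk) (by positivity)
  simpa using this

/-- Ladyzhenskaya's inequality for mean-free functions. -/
theorem normL4_sq_le {f : Lp ℂ 2 cellMeasure} {g : Fin 2 → Lp ℂ 2 cellMeasure}
    (h : ∀ j, IsFourierDeriv j f (g j)) (h0 : inner ℂ (modeLp 0) f = 0) :
    normL4 f ^ 2 ≤ 3 * (‖f‖ * √(∑ j, ‖g j‖ ^ 2)) := by
  set D := √(∑ j, ‖g j‖ ^ 2) with hD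
  have hD0 : 0 ≤ D := Real.sqrt_nonneg _
  have hfD : ‖f‖ ≤ D := Real.le_sqrt_of_sq_le (norm_sq_le_of_isFourierDeriv h h0)
  have hgD : ∀ j, ‖g j‖ ≤ D := fun j => Real.le_sqrt_of_sq_le
    (Finset.single_le_sum (f := fun j => ‖g j‖ ^ 2) (fun i _ => by positivity) (Finset.mem_univ j))
  -- The zeroth-order term of `sliceBound` is absorbed by Poincaré, `‖f‖ ≤ D`; together with the
  -- coefficient `2` of the other term this gives the constant `3`.
  have hpi : (2 * Real.pi)⁻¹ ≤ 1 := inv_le_one_of_one_le₀ (by linarith [Real.pi_gt_three])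
  have hs : ∀ j, sliceBound f (g j) ≤ 3 * (‖f‖ * D) := by
    intro j
    have h1 : (2 * Real.pi)⁻¹ * ‖f‖ ^ 2 ≤ 1 * (‖f‖ * D) := by
      rw [sq]; gcongr
    have h2 : 2 * (‖f‖ * ‖g j‖) ≤ 2 * (‖f‖ * D) := by gcongr; exact hgD j
    unfold sliceBound
    linarith
  have hB : 0 ≤ 3 * (‖f‖ * D) := by positivity
  have h4 : normL4 f ≤ ((3 * (‖f‖ * D)) ^ 2) ^ (4⁻¹ : ℝ) := by
    refine (normL4_le h).trans (Real.rpow_le_rpow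
      (mul_nonneg (sliceBound_nonneg _ _) (sliceBound_nonneg _ _)) ?_ (by norm_num))
    rw [sq]
    exact mul_le_mul (hs 0) (hs 1) (sliceBound_nonneg _ _) hB
  refine (pow_le_pow_left₀ (normL4_nonneg _) h4 2).trans (le_of_eq ?_)
  rw [← Real.rpow_natCast (3 * (‖f‖ * D)) 2, ← Real.rpow_mul hB, ← Real.rpow_natCast,
    ← Real.rpow_mul hB]
  norm_num

/-- The `L⁴` bound is applied to the tails, since the `L²` tails of both `f` and its derivatives
tend to zero. -/
theorem tendsto_normL4_partialSum_sub {f : Lp ℂ 2 cellMeasure} {g : Fin 2 → Lp ℂ 2 cellMeasure}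
    (h : ∀ j, IsFourierDeriv j f (g j)) :
    Tendsto (fun s => normL4 (partialSum s f - f : Lp ℂ 2 cellMeasure)) atTop (𝓝 0) := by
  have h0 : ∀ f : Lp ℂ 2 cellMeasure, Tendsto (fun s => partialSum s f - f) atTop (𝓝 0) := fun f =>
    tendsto_sub_nhds_zero_iff.2 (tendsto_partialSum f)
  have hb : ∀ j, Tendsto (fun s => sliceBound (partialSum s f - f) (partialSum s (g j) - g j)) atTop
      (𝓝 0) := fun j => by
    have := (((h0 f).norm.pow 2).const_mul (2 * Real.pi)⁻¹).add
      (((h0 f).norm.mul (h0 (g j)).norm).const_mul 2)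
    simpa [sliceBound] using this
  have h2 := ((hb 0).mul (hb 1)).rpow_const (p := (4⁻¹ : ℝ)) (Or.inr (by norm_num))
  rw [mul_zero, Real.zero_rpow (by norm_num)] at h2
  exact squeeze_zero (fun s => normL4_nonneg _)
    (fun s => normL4_le fun j => (h j).partialSum_sub s) h2

/-! ### Trilinear integrals -/

/-- Hölder's inequality with exponents `4`, `4`, `2`. -/
theorem integrable_mul_mul {a b c : Plane → ℂ} (ha : MemLp a 4 cellMeasure)
    (hb : MemLp b 4 cellMeasure) (hc : MemLp c 2 cellMeasure) :
    Integrable (fun x => a x * b x * c x) cellMeasure :=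
  (hb.mul ha : MemLp (a * b) 2 cellMeasure).integrable_mul hc

theorem norm_integral_mul_mul_le {a b c : Plane → ℂ} (ha : MemLp a 4 cellMeasure)
    (hb : MemLp b 4 cellMeasure) (hc : MemLp c 2 cellMeasure) :
    ‖∫ x, a x * b x * c x ∂cellMeasure‖ ≤
      normL4 a * normL4 b * (eLpNorm c 2 cellMeasure).toReal := by
  have hab : MemLp (a * b) 2 cellMeasure := hb.mul ha
  refine (norm_integral_le_integral_norm _).trans ?_
  rw [integral_norm_eq_lintegral_enorm (integrable_mul_mul ha hb hc).aestronglyMeasurable,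
    ← eLpNorm_one_eq_lintegral_enorm]
  have h1 : eLpNorm (fun x => a x * b x * c x) 1 cellMeasure ≤
      eLpNorm (a * b) 2 cellMeasure * eLpNorm c 2 cellMeasure :=
    eLpNorm_smul_le_mul_eLpNorm (p := 2) (q := 2) (r := 1) (φ := a * b) (f := c) hc.1 hab.1
  have h2 : eLpNorm (a * b) 2 cellMeasure ≤ eLpNorm a 4 cellMeasure * eLpNorm b 4 cellMeasure :=
    eLpNorm_smul_le_mul_eLpNorm (p := 4) (q := 4) (r := 2) (φ := a) (f := b) hb.1 ha.1
  rw [normL4, normL4, ← ENNReal.toReal_mul, ← ENNReal.toReal_mul]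
  refine ENNReal.toReal_mono ?_ (h1.trans (mul_le_mul_left h2 _))
  exact ENNReal.mul_ne_top (ENNReal.mul_ne_top ha.2.ne hb.2.ne) hc.2.ne

theorem memLp_conj {p : ℝ≥0∞} {f : Plane → ℂ} (hf : MemLp f p cellMeasure) :
    MemLp (fun x => starRingEnd ℂ (f x)) p cellMeasure :=
  hf.of_le (Complex.continuous_conj.comp_aestronglyMeasurable hf.1)
    (ae_of_all _ fun x => (RCLike.norm_conj (f x)).le)

theorem normL4_conj (f : Plane → ℂ) : normL4 (fun x => starRingEnd ℂ (f x)) = normL4 f := by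
  unfold normL4
  rw [eLpNorm_congr_norm_ae (ae_of_all _ fun x => RCLike.norm_conj (f x))]

/-- The difference splits into a term with `partialSum s f - f`, small in `L⁴`, and a term with
`partialSum s (g j) - g j`, small in `L²`. Hölder's inequality handles each. -/
theorem tendsto_integral_partialSum {a : Plane → ℂ} (ha : MemLp a 4 cellMeasure)
    {f : Lp ℂ 2 cellMeasure} {g : Fin 2 → Lp ℂ 2 cellMeasure}
    (h : ∀ j, IsFourierDeriv j f (g j)) (j : Fin 2) :
    Tendsto (fun s =>
        ∫ x, a x * starRingEnd ℂ (partialSum s f x) * partialSum s (g j) x ∂cellMeasure)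
      atTop (𝓝 (∫ x, a x * starRingEnd ℂ (f x) * g j x ∂cellMeasure)) := by
  have hf := memLp_four h
  have hdf := fun s => memLp_four fun j => (h j).partialSum_sub s
  rw [← tendsto_sub_nhds_zero_iff]
  refine squeeze_zero_norm (a := fun s =>
    normL4 a * normL4 (partialSum s f - f : Lp ℂ 2 cellMeasure) * ‖partialSum s (g j)‖ +
    normL4 a * normL4 f * ‖partialSum s (g j) - g j‖) (fun s => ?_) ?_
  · have e1 := norm_integral_mul_mul_le ha (memLp_conj (hdf s)) (Lp.memLp (partialSum s (g j)))
    have e2 := norm_integral_mul_mul_le ha (memLp_conj hf) (Lp.memLp (partialSum s (g j) - g j))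
    rw [normL4_conj, ← Lp.norm_def] at e1 e2
    have i1 := integrable_mul_mul ha (memLp_conj (hdf s)) (Lp.memLp (partialSum s (g j)))
    have i2 := integrable_mul_mul ha (memLp_conj hf) (Lp.memLp (partialSum s (g j) - g j))
    have i3 := integrable_mul_mul ha (memLp_conj hf) (Lp.memLp (g j))
    have : ∫ x, a x * starRingEnd ℂ (partialSum s f x) * partialSum s (g j) x ∂cellMeasure =
        ∫ x, (a x * starRingEnd ℂ ((partialSum s f - f : Lp ℂ 2 cellMeasure) x) *
          partialSum s (g j) x + a x * starRingEnd ℂ (f x) *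
          ((partialSum s (g j) - g j : Lp ℂ 2 cellMeasure) x) +
          a x * starRingEnd ℂ (f x) * g j x) ∂cellMeasure := by
      refine integral_congr_ae ?_
      filter_upwards [Lp.coeFn_sub (partialSum s f) f, Lp.coeFn_sub (partialSum s (g j)) (g j)]
        with x h1 h2
      rw [h1, h2, Pi.sub_apply, Pi.sub_apply, map_sub]
      ring
    rw [this, integral_add (by exact i1.add i2) i3, integral_add i1 i2, add_sub_cancel_right]
    exact (norm_add_le _ _).trans (add_le_add e1 e2)
  · have t1 := ((tendsto_normL4_partialSum_sub h).const_mul (normL4 a)).mul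
      (tendsto_partialSum (g j)).norm
    have t2 := ((tendsto_sub_nhds_zero_iff.2 (tendsto_partialSum (g j))).norm).const_mul
      (normL4 a * normL4 f)
    simpa using t1.add t2

/-- A divergence-free field transports without changing the `L²` norm. -/
theorem IsDivFree.re_sum_integral_eq_zero {u : L2} (hu : IsDivFree u)
    (hu4 : ∀ j, MemLp (fun x => (u x j : ℂ)) 4 cellMeasure)
    {f : Lp ℂ 2 cellMeasure} {g : Fin 2 → Lp ℂ 2 cellMeasure} (h : ∀ j, IsFourierDeriv j f (g j)) :
    (∑ j, ∫ x, (u x j : ℂ) * starRingEnd ℂ (f x) * g j x ∂cellMeasure).re = 0 := by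
  have ht := (Complex.continuous_re.tendsto _).comp
    (tendsto_finsetSum Finset.univ fun j _ => tendsto_integral_partialSum (hu4 j) h j)
  refine tendsto_nhds_unique ht (tendsto_const_nhds.congr fun s => ?_)
  -- For a partial sum `T`, the smooth periodic function `|T|²` is an admissible test function and
  -- `∂_j |T|² = 2 Re (conj T · ∂_j T)`, so the real part vanishes before the limit is taken.
  have hz := hu _ (isTest_norm_sq_trigSum s fun k => inner ℂ (modeLp k) f)
  have hds := fun s => memLp_four fun j => (h j).partialSum_sub s
  have hsm : MemLp (partialSum s f) 4 cellMeasure := by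
    have := (hds s).add (memLp_four h)
    refine this.ae_eq ?_
    filter_upwards [Lp.coeFn_sub (partialSum s f) f] with x hx
    rw [Pi.add_apply, hx]; simp
  have hi := fun j => integrable_mul_mul (hu4 j) (memLp_conj hsm) (Lp.memLp (partialSum s (g j)))
  change 0 = (∑ j, ∫ x, (u x j : ℂ) * starRingEnd ℂ (partialSum s f x) *
    partialSum s (g j) x ∂cellMeasure).re
  rw [← integral_finsetSum _ fun j _ => hi j]
  have h1 : (∫ x, ∑ j, (u x j : ℂ) * starRingEnd ℂ (partialSum s f x) *
      partialSum s (g j) x ∂cellMeasure).re = ∫ x, (∑ j, (u x j : ℂ) *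
      starRingEnd ℂ (partialSum s f x) * partialSum s (g j) x).re ∂cellMeasure :=
    (integral_re (integrable_finsetSum _ fun j _ => hi j)).symm
  rw [h1]
  have h2 : ∫ x, ∑ j, partialDeriv j
      (fun x => ‖trigSum s (fun k => inner ℂ (modeLp k) f) x‖ ^ 2) x * u x j ∂cellMeasure =
      2 * ∫ x, (∑ j, (u x j : ℂ) * starRingEnd ℂ (partialSum s f x) *
        partialSum s (g j) x).re ∂cellMeasure := by
    rw [← integral_const_mul]
    refine integral_congr_ae ?_
    filter_upwards [coeFn_partialSum s f, (h 0).coeFn_partialSum s, (h 1).coeFn_partialSum s]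
      with x h0 h1 h2
    simp only [Fin.sum_univ_two, partialDeriv_norm_sq_trigSum, h0, h1, h2, mul_assoc,
      Complex.add_re, Complex.re_ofReal_mul]
    ring
  rw [h2] at hz
  linarith

/-! ### Components of vector fields -/

/-- The `i`-th component of a vector field, as a complex function. -/
def comp (i : Fin 2) : L2 →L[ℝ] Lp ℂ 2 cellMeasure :=
  ContinuousLinearMap.compLpL 2 cellMeasure (Complex.ofRealCLM.comp (EuclideanSpace.proj i))

theorem coeFn_comp (i : Fin 2) (u : L2) : comp i u =ᵐ[cellMeasure] fun x => (u x i : ℂ) :=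
  ContinuousLinearMap.coeFn_compLpL _ u

theorem inner_eq_sum_comp (u v : L2) :
    inner ℝ u v = ∑ i, (inner ℂ (comp i u) (comp i v)).re := by
  have h : ∀ i, (inner ℂ (comp i u) (comp i v)).re =
      ∫ x, (inner ℂ (comp i u x) (comp i v x)).re ∂cellMeasure := fun i =>
    (integral_re (L2.integrable_inner (𝕜 := ℂ) (comp i u) (comp i v))).symm
  have hi : ∀ i, Integrable (fun x => (inner ℂ (comp i u x) (comp i v x)).re) cellMeasure :=
    fun i => (L2.integrable_inner (𝕜 := ℂ) (comp i u) (comp i v)).re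
  simp only [h]
  rw [← integral_finsetSum _ fun i _ => hi i, L2.inner_def]
  refine integral_congr_ae ?_
  filter_upwards [coeFn_comp 0 u, coeFn_comp 1 u, coeFn_comp 0 v, coeFn_comp 1 v] with x h1 h2 h3 h4
  simp [PiLp.inner_apply, Fin.sum_univ_two, h1, h2, h3, h4]

theorem norm_sq_eq_sum_comp (u : L2) : ‖u‖ ^ 2 = ∑ i, ‖comp i u‖ ^ 2 := by
  rw [← real_inner_self_eq_norm_sq, inner_eq_sum_comp]
  exact Finset.sum_congr rfl fun i _ => inner_self_eq_norm_sq (𝕜 := ℂ) (comp i u)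

theorem norm_comp_le (i : Fin 2) (u : L2) : ‖comp i u‖ ≤ ‖u‖ := by
  refine le_of_sq_le_sq ?_ (norm_nonneg u)
  rw [norm_sq_eq_sum_comp u]
  exact Finset.single_le_sum (f := fun i => ‖comp i u‖ ^ 2) (fun i _ => by positivity)
    (Finset.mem_univ i)

/-! ### Testing against Fourier modes -/

/-- The real Fourier mode `Re (z e^{i k·x})`. -/
def reMode (z : ℂ) (k : Fin 2 → ℤ) (x : Plane) : ℝ := (z * expMode k x).re

theorem isTest_reMode (z : ℂ) (k : Fin 2 → ℤ) : IsTest (reMode z k) :=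
  ⟨Complex.reCLM.contDiff.comp (contDiff_const.mul (contDiff_expMode k)), fun j x => by
    simp only [reMode, expMode_periodic]⟩

theorem partialDeriv_reMode (z : ℂ) (k : Fin 2 → ℤ) (j : Fin 2) :
    partialDeriv j (reMode z k) = reMode (z * (Complex.I * k j)) k := by
  funext x
  have h : HasFDerivAt (reMode z k) (Complex.reCLM.comp (z • fderiv ℝ (expMode k) x)) x :=
    Complex.reCLM.hasFDerivAt.comp x
      ((((contDiff_expMode k).differentiable (by simp)) x).hasFDerivAt.const_mul z)
  rw [partialDeriv, h.fderiv]
  simp only [ContinuousLinearMap.comp_apply, smul_apply, fderiv_expMode, smul_eq_mul,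
    Complex.reCLM_apply, reMode, mul_assoc]

/-- The integral `∫ e^{i k·x} u_i`. -/
def modeIntegral (k : Fin 2 → ℤ) (i : Fin 2) (u : L2) : ℂ :=
  ∫ x, expMode k x * (u x i : ℂ) ∂cellMeasure

theorem integrable_comp (u : L2) : Integrable (u : Plane → Plane) cellMeasure :=
  (Lp.memLp u).integrable (by norm_num)

theorem integrable_coord (u : L2) (i : Fin 2) : Integrable (fun x => u x i) cellMeasure :=
  (EuclideanSpace.proj (𝕜 := ℝ) i).integrable_comp (integrable_comp u)

theorem integrable_expMode_mul (k : Fin 2 → ℤ) (i : Fin 2) (u : L2) :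
    Integrable (fun x => expMode k x * (u x i : ℂ)) cellMeasure :=
  (integrable_coord u i).ofReal.bdd_mul (c := 1) (continuous_expMode k).aestronglyMeasurable
    (ae_of_all _ fun x => (norm_expMode k x).le)

theorem re_mul_expMode (z : ℂ) (k : Fin 2 → ℤ) (x : Plane) (r : ℝ) :
    reMode z k x * r = (z * (expMode k x * (r : ℂ))).re := by
  rw [← mul_assoc, Complex.re_mul_ofReal, reMode]

theorem integrable_reMode_mul (z : ℂ) (k : Fin 2 → ℤ) (i : Fin 2) (u : L2) :
    Integrable (fun x => reMode z k x * u x i) cellMeasure := by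
  simp only [re_mul_expMode]
  exact ((integrable_expMode_mul k i u).const_mul z).re

theorem integral_reMode_mul (z : ℂ) (k : Fin 2 → ℤ) (i : Fin 2) (u : L2) :
    ∫ x, reMode z k x * u x i ∂cellMeasure = (z * modeIntegral k i u).re := by
  simp only [re_mul_expMode]
  rw [modeIntegral, ← integral_const_mul]
  exact integral_re ((integrable_expMode_mul k i u).const_mul z)

theorem inner_modeLp_comp (k : Fin 2 → ℤ) (i : Fin 2) (u : L2) :
    inner ℂ (modeLp k) (comp i u) =
      ((2 * Real.pi)⁻¹ : ℂ) * starRingEnd ℂ (modeIntegral k i u) := by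
  rw [inner_modeLp, modeIntegral, ← integral_conj]
  congr 1
  refine integral_congr_ae ?_
  filter_upwards [coeFn_comp i u] with x hx
  rw [hx, map_mul, Complex.conj_ofReal]

/-- Test functions are real-valued, so complex identities for Fourier integrals are recovered by
letting the amplitude `z` of `reMode z k` vary. -/
theorem eq_zero_of_forall_re_mul {a : ℂ} (h : ∀ z : ℂ, (z * a).re = 0) : a = 0 := by
  have := h (starRingEnd ℂ a)
  rw [← Complex.normSq_eq_conj_mul_self, Complex.ofReal_re] at this
  exact Complex.normSq_eq_zero.1 this

theorem apply_integral (i : Fin 2) {f : Plane → Plane} (hf : Integrable f cellMeasure) :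
    (∫ x, f x ∂cellMeasure) i = ∫ x, f x i ∂cellMeasure :=
  ((EuclideanSpace.proj (𝕜 := ℝ) i).integral_comp_comm hf).symm

theorem integrable_test_smul {φ : Plane → ℝ} (hφ : Continuous φ) (u : L2) :
    Integrable (fun x => φ x • u x) cellMeasure := by
  simpa using integrable_apply (fun x => φ x • ContinuousLinearMap.id ℝ Plane)
    (hφ.smul continuous_const) u

/-- Testing with `reMode z k` gives `i k_j ∫ e^{ik·x} u = -∫ e^{ik·x} g`. The coefficients pair with
the conjugate exponential, and conjugation turns the sign into the one in `IsFourierDeriv`. -/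
theorem HasWeakPartial.isFourierDeriv {j : Fin 2} {u g : L2} (h : HasWeakPartial j u g)
    (i : Fin 2) : IsFourierDeriv j (comp i u) (comp i g) := by
  intro k
  have hz : ∀ z : ℂ, (z * (Complex.I * k j * modeIntegral k i u + modeIntegral k i g)).re = 0 := by
    intro z
    have h1 := congrArg (fun y : Plane => y i) (h _ (isTest_reMode z k))
    simp only [PiLp.neg_apply] at h1
    rw [apply_integral i (integrable_test_smul (isTest_reMode z k).1.continuous g),
      apply_integral i (integrable_test_smul
        (continuous_partialDeriv (isTest_reMode z k) j) u)] at h1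
    simp only [partialDeriv_reMode, PiLp.smul_apply, smul_eq_mul, integral_reMode_mul] at h1
    rw [mul_add, Complex.add_re, ← mul_assoc, h1]
    ring
  have h0 := eq_zero_of_forall_re_mul hz
  rw [inner_modeLp_comp, inner_modeLp_comp, eq_neg_of_add_eq_zero_right h0]
  simp only [map_neg, map_mul, Complex.conj_I, map_intCast]
  ring

/-- The gradient of `reMode z k` is parallel to `k`, so testing the divergence condition with it
isolates `k · û`. -/
theorem IsDivFree.sum_mul_modeIntegral {u : L2} (hu : IsDivFree u) (k : Fin 2 → ℤ) :
    ∑ j, (k j : ℂ) * modeIntegral k j u = 0 := by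
  have hz : ∀ z : ℂ, (z * (Complex.I * ∑ j, (k j : ℂ) * modeIntegral k j u)).re = 0 := by
    intro z
    have h1 := hu _ (isTest_reMode z k)
    simp only [partialDeriv_reMode] at h1
    rw [integral_finsetSum _ fun j _ => integrable_reMode_mul _ k j u] at h1
    simp only [integral_reMode_mul] at h1
    rw [← h1, Finset.mul_sum, Finset.mul_sum, Complex.re_sum]
    refine Finset.sum_congr rfl fun j _ => ?_
    congr 1
    ring
  exact (mul_eq_zero.1 (eq_zero_of_forall_re_mul hz)).resolve_left Complex.I_ne_zero

theorem modeIntegral_zero {u : L2} (hu : IsMeanFree u) (i : Fin 2) : modeIntegral 0 i u = 0 := by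
  have h1 := apply_integral i (integrable_comp u)
  rw [hu] at h1
  have h2 : ∀ x, expMode 0 x = 1 := fun x => by
    rw [expMode, inner_waveVec]; simp
  simp only [modeIntegral, h2, one_mul]
  have h3 : ∫ x, ((u x i : ℝ) : ℂ) ∂cellMeasure = ((∫ x, u x i ∂cellMeasure : ℝ) : ℂ) :=
    integral_ofReal
  rw [h3, ← h1]; simp

theorem inner_modeLp_zero_comp {u : L2} (hu : IsMeanFree u) (i : Fin 2) :
    inner ℂ (modeLp 0) (comp i u) = 0 := by
  rw [inner_modeLp_comp, modeIntegral_zero hu]; simp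

/-! ### Gradients -/

/-- The fields `d_j` are the weak partial derivatives of `u`. -/
def IsGrad (u : L2) (d : Fin 2 → L2) : Prop := ∀ j, HasWeakPartial j u (d j)

/-- The `L²` norm of a gradient. -/
def gradNorm (d : Fin 2 → L2) : ℝ := √(∑ j, ‖d j‖ ^ 2)

theorem gradNorm_nonneg (d : Fin 2 → L2) : 0 ≤ gradNorm d := Real.sqrt_nonneg _

theorem gradNorm_sq (d : Fin 2 → L2) : gradNorm d ^ 2 = ∑ j, ‖d j‖ ^ 2 :=
  Real.sq_sqrt (Finset.sum_nonneg fun j _ => by positivity)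

theorem IsGrad.comp {u : L2} {d : Fin 2 → L2} (h : IsGrad u d) (i j : Fin 2) :
    IsFourierDeriv j (comp i u) (NSE.comp i (d j)) := (h j).isFourierDeriv i

theorem IsFourierDeriv.sub {j : Fin 2} {f g f' g' : Lp ℂ 2 cellMeasure}
    (h : IsFourierDeriv j f g) (h' : IsFourierDeriv j f' g') :
    IsFourierDeriv j (f - f') (g - g') := fun k => by
  rw [inner_sub_right, inner_sub_right, h k, h' k]; ring

theorem InV.isGrad {u : H} (hu : InV u) : IsGrad u fun j => weakPartial j u := fun j => by
  have h : weakPartial j (u : L2) = (hu j).choose := dif_pos (hu j)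
  simp only [h]
  exact (hu j).choose_spec

theorem InDA.isGrad {u : H} (hu : InDA u) (j : Fin 2) :
    IsGrad (weakPartial j u) fun i => weakPartial i (weakPartial j u) := fun i => by
  have h : weakPartial i (weakPartial j (u : L2)) = (hu.2 i j).choose := dif_pos (hu.2 i j)
  simp only [h]
  exact (hu.2 i j).choose_spec

theorem IsGrad.sub {u v : L2} {d e : Fin 2 → L2} (h : IsGrad u d) (h' : IsGrad v e) :
    IsGrad (u - v) fun j => d j - e j := by
  intro j φ hφ
  have hi := fun {ψ : Plane → ℝ} (hψ : Continuous ψ) (u : L2) => integrable_test_smul hψ u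
  have hs : ∀ {ψ : Plane → ℝ} (_ : Continuous ψ) (u v : L2),
      ∫ x, ψ x • (u - v : L2) x ∂cellMeasure =
        ∫ x, ψ x • u x ∂cellMeasure - ∫ x, ψ x • v x ∂cellMeasure := by
    intro ψ hψ u v
    rw [← integral_sub (hi hψ u) (hi hψ v)]
    refine integral_congr_ae ?_
    filter_upwards [Lp.coeFn_sub u v] with x hx
    rw [hx, Pi.sub_apply, smul_sub]
  rw [hs (continuous_partialDeriv hφ j), hs hφ.1.continuous, h j φ hφ, h' j φ hφ]
  abel

theorem IsGrad.memLp_four {u : L2} {d : Fin 2 → L2} (h : IsGrad u d) (i : Fin 2) :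
    MemLp (NSE.comp i u) 4 cellMeasure := NSE.memLp_four fun j => h.comp i j

theorem sum_norm_comp_sq_le (d : Fin 2 → L2) (i : Fin 2) :
    ∑ j, ‖comp i (d j)‖ ^ 2 ≤ ∑ j, ‖d j‖ ^ 2 :=
  Finset.sum_le_sum fun j _ => pow_le_pow_left₀ (norm_nonneg _) (norm_comp_le i (d j)) 2

theorem norm_comp_le_gradNorm (d : Fin 2 → L2) (i j : Fin 2) : ‖comp i (d j)‖ ≤ gradNorm d := by
  refine Real.le_sqrt_of_sq_le (le_trans ?_ (sum_norm_comp_sq_le d i))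
  exact Finset.single_le_sum (f := fun j => ‖comp i (d j)‖ ^ 2) (fun i _ => by positivity)
    (Finset.mem_univ j)

theorem IsGrad.normL4_sq_le {u : H} {d : Fin 2 → L2} (h : IsGrad u d) (i : Fin 2) :
    normL4 (NSE.comp i (u : L2)) ^ 2 ≤ 3 * (‖u‖ * gradNorm d) := by
  refine (NSE.normL4_sq_le (fun j => h.comp i j) (inner_modeLp_zero_comp u.2.1 i)).trans ?_
  gcongr
  · exact norm_comp_le i (u : L2)
  · exact Real.sqrt_le_sqrt (sum_norm_comp_sq_le d i)

/-- The Poincaré inequality for vector fields. -/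
theorem IsGrad.norm_le {u : H} {d : Fin 2 → L2} (h : IsGrad u d) : ‖u‖ ≤ gradNorm d := by
  refine Real.le_sqrt_of_sq_le ?_
  change ‖(u : L2)‖ ^ 2 ≤ _
  rw [norm_sq_eq_sum_comp]
  simp only [norm_sq_eq_sum_comp (d _)]
  rw [Finset.sum_comm]
  exact Finset.sum_le_sum fun i _ =>
    norm_sq_le_of_isFourierDeriv (fun j => h.comp i j) (inner_modeLp_zero_comp u.2.1 i)

/-! ### The Stokes operator -/

theorem inner_leray (a : L2) (w : H) : inner ℝ (leray a) w = inner ℝ a (w : L2) :=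
  Submodule.inner_orthogonalProjectionOnto_eq_of_mem_right w a

theorem HasWeakPartial.inner_eq {j : Fin 2} {a b c d : L2} (h : HasWeakPartial j a b)
    (h' : HasWeakPartial j c d) : inner ℝ b c = - inner ℝ a d := by
  rw [inner_eq_sum_comp, inner_eq_sum_comp, ← Finset.sum_neg_distrib]
  refine Finset.sum_congr rfl fun i _ => ?_
  rw [(h.isFourierDeriv i).inner_eq (h'.isFourierDeriv i), Complex.neg_re]

theorem inner_stokes {u w : H} (hu : InDA u) {d : Fin 2 → L2} (hw : IsGrad w d) :
    inner ℝ (stokes u) w = ∑ j, inner ℝ (weakPartial j (u : L2)) (d j) := by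
  rw [stokes, inner_neg_left, inner_leray, sum_inner, ← Finset.sum_neg_distrib]
  refine Finset.sum_congr rfl fun j _ => ?_
  rw [(hu.isGrad j j).inner_eq (hw j), neg_neg]

theorem inner_stokes_self {u : H} (hu : InDA u) :
    inner ℝ (stokes u) u = gradNorm (fun j => weakPartial j (u : L2)) ^ 2 := by
  rw [inner_stokes hu hu.1.isGrad, gradNorm_sq]
  exact Finset.sum_congr rfl fun j _ => real_inner_self_eq_norm_sq _

theorem inner_stokes_sub {u v : H} (hu : InDA u) (hv : InDA v) :
    inner ℝ (stokes u - stokes v) (u - v) =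
      gradNorm (fun j => weakPartial j (u : L2) - weakPartial j (v : L2)) ^ 2 := by
  have hw : IsGrad ((u - v : H) : L2)
    (fun j => weakPartial j (u : L2) - weakPartial j (v : L2)) := hu.1.isGrad.sub hv.1.isGrad
  rw [inner_sub_left, inner_stokes hu hw, inner_stokes hv hw, gradNorm_sq,
    ← Finset.sum_sub_distrib]
  exact Finset.sum_congr rfl fun j _ => by
    rw [← inner_sub_left, real_inner_self_eq_norm_sq]

/-! ### The nonlinear term -/

/-- The trilinear form `∫ ∑_j a_j d_j · w`. -/
def trilin (a : L2) (d : Fin 2 → L2) (w : L2) : ℝ :=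
  ∑ i, (∑ j, ∫ x, comp j a x * starRingEnd ℂ (comp i w x) * comp i (d j) x ∂cellMeasure).re

/-- All components of a vector field are in `L⁴`. -/
def InL4 (u : L2) : Prop := ∀ i, MemLp (comp i u) 4 cellMeasure

theorem IsGrad.inL4 {u : L2} {d : Fin 2 → L2} (h : IsGrad u d) : InL4 u := fun i => h.memLp_four i

theorem integrable_trilin {a w : L2} (ha : InL4 a) (hw : InL4 w) (d : L2) (i j : Fin 2) :
    Integrable (fun x => comp j a x * starRingEnd ℂ (comp i w x) * comp i d x) cellMeasure :=
  integrable_mul_mul (ha j) (memLp_conj (hw i)) (Lp.memLp (comp i d))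

theorem trilin_sub_left {a b w : L2} (ha : InL4 a) (hb : InL4 b) (hw : InL4 w) (d : Fin 2 → L2) :
    trilin (a - b) d w = trilin a d w - trilin b d w := by
  simp only [trilin]
  rw [← Finset.sum_sub_distrib]
  refine Finset.sum_congr rfl fun i _ => ?_
  rw [← Complex.sub_re, ← Finset.sum_sub_distrib]
  congr 1
  refine Finset.sum_congr rfl fun j _ => ?_
  rw [← integral_sub (integrable_trilin ha hw _ i j) (integrable_trilin hb hw _ i j), map_sub]
  refine integral_congr_ae ?_
  filter_upwards [Lp.coeFn_sub (comp j a) (comp j b)] with x hx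
  rw [hx, Pi.sub_apply]
  ring

theorem trilin_sub_mid {a w : L2} (ha : InL4 a) (hw : InL4 w) (d e : Fin 2 → L2) :
    trilin a (fun j => d j - e j) w = trilin a d w - trilin a e w := by
  simp only [trilin]
  rw [← Finset.sum_sub_distrib]
  refine Finset.sum_congr rfl fun i _ => ?_
  rw [← Complex.sub_re, ← Finset.sum_sub_distrib]
  congr 1
  refine Finset.sum_congr rfl fun j _ => ?_
  rw [← integral_sub (integrable_trilin ha hw _ i j) (integrable_trilin ha hw _ i j), map_sub]
  refine integral_congr_ae ?_
  filter_upwards [Lp.coeFn_sub (comp i (d j)) (comp i (e j))] with x hx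
  rw [hx, Pi.sub_apply]
  ring

/-- Each component of `w` is transported by the divergence-free field `u`, so each summand vanishes
separately. -/
theorem trilin_self_eq_zero {u : H} (hu : InL4 (u : L2)) {w : L2} {d : Fin 2 → L2}
    (hw : IsGrad w d) : trilin u d w = 0 := by
  refine Finset.sum_eq_zero fun i _ => ?_
  have hu4 : ∀ j, MemLp (fun x => ((u : L2) x j : ℂ)) 4 cellMeasure := fun j =>
    (hu j).ae_eq (coeFn_comp j u)
  rw [← u.2.2.re_sum_integral_eq_zero hu4 fun j => hw.comp i j]
  congr 1
  refine Finset.sum_congr rfl fun j _ => integral_congr_ae ?_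
  filter_upwards [coeFn_comp j (u : L2)] with x hx
  rw [hx]

/-- Hölder with exponents `4, 4, 2` and Ladyzhenskaya with constant `3` bound each of the four pairs
`(i, j)`, whence `12`. -/
theorem abs_trilin_le {w : H} {e : Fin 2 → L2} (hw : IsGrad w e) (d : Fin 2 → L2) :
    |trilin w d w| ≤ 12 * (‖w‖ * gradNorm e * gradNorm d) := by
  have h4 : ∀ i j, normL4 (comp j (w : L2)) * normL4 (comp i (w : L2)) ≤
      3 * (‖w‖ * gradNorm e) := by
    intro i j
    have h1 := hw.normL4_sq_le i
    have h2 := hw.normL4_sq_le j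
    nlinarith [sq_nonneg (normL4 (comp j (w : L2)) - normL4 (comp i (w : L2)))]
  have hb : ∀ i j, ‖∫ x, comp j (w : L2) x * starRingEnd ℂ (comp i (w : L2) x) * comp i (d j) x
      ∂cellMeasure‖ ≤ 3 * (‖w‖ * gradNorm e) * gradNorm d := by
    intro i j
    have h := norm_integral_mul_mul_le (hw.inL4 j) (memLp_conj (hw.inL4 i))
      (Lp.memLp (comp i (d j)))
    rw [normL4_conj, ← Lp.norm_def] at h
    refine h.trans (mul_le_mul (h4 i j) (norm_comp_le_gradNorm d i j) (norm_nonneg _) ?_)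
    exact mul_nonneg (by norm_num) (mul_nonneg (norm_nonneg _) (gradNorm_nonneg _))
  have hi : ∀ i, |(∑ j, ∫ x, comp j (w : L2) x * starRingEnd ℂ (comp i (w : L2) x) * comp i (d j) x
      ∂cellMeasure).re| ≤ 2 * (3 * (‖w‖ * gradNorm e) * gradNorm d) := by
    intro i
    refine (Complex.abs_re_le_norm _).trans ((norm_sum_le _ _).trans ?_)
    rw [Fin.sum_univ_two]
    linarith [hb i 0, hb i 1]
  refine (Finset.abs_sum_le_sum_abs _ _).trans ?_
  rw [Fin.sum_univ_two]
  linarith [hi 0, hi 1]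

theorem InL4.memLp {u : L2} (h : InL4 u) : MemLp u 4 cellMeasure := by
  refine ((h 0).norm.add (h 1).norm).of_le (Lp.memLp u).aestronglyMeasurable ?_
  filter_upwards [coeFn_comp 0 u, coeFn_comp 1 u] with x h0 h1
  rw [Pi.add_apply, h0, h1, Complex.norm_real, Complex.norm_real, Real.norm_of_nonneg
    (add_nonneg (norm_nonneg _) (norm_nonneg _)), EuclideanSpace.norm_eq, Fin.sum_univ_two]
  exact Real.sqrt_le_iff.2 ⟨by positivity, by nlinarith [norm_nonneg (u x 0), norm_nonneg (u x 1)]⟩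

/-- For `u` in `D(A)` the first derivatives have `L²` gradients of their own, so they lie in `L⁴`
like `u`, and the products lie in `L²`. Hence `bilin u u` takes its genuine value and not the
default `0`. -/
theorem InDA.memLp_advect {u : H} (hu : InDA u) : MemLp (advect u u) 2 cellMeasure := by
  have hu4 := hu.1.isGrad.inL4.memLp
  have hc : ∀ j, MemLp (fun x => (u : L2) x j) 4 cellMeasure := fun j =>
    hu4.of_le ((integrable_coord (u : L2) j).aestronglyMeasurable)
      (ae_of_all _ fun x => PiLp.norm_apply_le ((u : L2) x) j)
  exact memLp_finsetSum _ fun j _ => ((hu.isGrad j).inL4.memLp).smul (hc j)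

theorem inner_bilin {u w : H} (hu : InDA u) (hw : InL4 (w : L2)) :
    inner ℝ (bilin u u) w = trilin u (fun j => weakPartial j (u : L2)) w := by
  rw [bilin, dif_pos hu.memLp_advect, inner_leray, L2.inner_def]
  have hi := fun i j => integrable_trilin hu.1.isGrad.inL4 hw (weakPartial j (u : L2)) i j
  have h1 : trilin u (fun j => weakPartial j (u : L2)) w = ∫ x, ∑ i, (∑ j, comp j (u : L2) x *
      starRingEnd ℂ (comp i (w : L2) x) * comp i (weakPartial j (u : L2)) x).re ∂cellMeasure := by
    have hir : ∀ i, Integrable (fun x => (∑ j, comp j (u : L2) x *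
        starRingEnd ℂ (comp i (w : L2) x) * comp i (weakPartial j (u : L2)) x).re) cellMeasure :=
      fun i => (integrable_finsetSum Finset.univ fun j _ => hi i j).re
    rw [integral_finsetSum _ fun i _ => hir i]
    refine Finset.sum_congr rfl fun i _ => ?_
    rw [← integral_finsetSum _ fun j _ => hi i j]
    exact (integral_re (integrable_finsetSum _ fun j _ => hi i j)).symm
  rw [h1]
  refine integral_congr_ae ?_
  have hd : ∀ j i, comp i (weakPartial j (u : L2)) =ᵐ[cellMeasure]
    fun x => ((weakPartial j (u : L2)) x i : ℂ) := fun j i => coeFn_comp i _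
  filter_upwards [hu.memLp_advect.coeFn_toLp, coeFn_comp 0 (u : L2), coeFn_comp 1 (u : L2),
    coeFn_comp 0 (w : L2), coeFn_comp 1 (w : L2), hd 0 0, hd 0 1, hd 1 0, hd 1 1]
    with x h0 h1 h2 h3 h4 h5 h6 h7 h8
  rw [h0]
  simp only [advect, PiLp.inner_apply, Fin.sum_univ_two, h1, h2, h3, h4, h5, h6, h7, h8,
    Complex.conj_ofReal, PiLp.add_apply, PiLp.smul_apply, smul_eq_mul, Complex.add_re,
    ← Complex.ofReal_mul, Complex.ofReal_re, RCLike.inner_apply, conj_trivial]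
  ring

theorem inner_bilin_self {u : H} (hu : InDA u) : inner ℝ (bilin u u) u = 0 := by
  rw [inner_bilin hu hu.1.isGrad.inL4, trilin_self_eq_zero hu.1.isGrad.inL4 hu.1.isGrad]

/-- With `w = u - v`, `(u·∇)u - (v·∇)v = (w·∇)u + (v·∇)w`, and the last term is orthogonal to `w`.
Only the gradient of `u` remains, which is why the energy of one solution suffices later. -/
theorem abs_inner_bilin_sub_le {u v : H} (hu : InDA u) (hv : InDA v) :
    |inner ℝ (bilin u u - bilin v v) (u - v)| ≤ 12 * (‖u - v‖ *
      gradNorm (fun j => weakPartial j (u : L2) - weakPartial j (v : L2)) *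
      gradNorm (fun j => weakPartial j (u : L2))) := by
  have hw : IsGrad ((u - v : H) : L2)
    (fun j => weakPartial j (u : L2) - weakPartial j (v : L2)) := hu.1.isGrad.sub hv.1.isGrad
  have hu4 := hu.1.isGrad.inL4
  have hv4 := hv.1.isGrad.inL4
  have h1 := trilin_sub_left hu4 hv4 hw.inL4 fun j => weakPartial j (u : L2)
  have h2 := trilin_sub_mid hv4 hw.inL4 (fun j => weakPartial j (u : L2))
    fun j => weakPartial j (v : L2)
  have h3 : inner ℝ (bilin u u - bilin v v) (u - v) =
      trilin (u - v : H) (fun j => weakPartial j (u : L2)) (u - v : H) := by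
    rw [inner_sub_left, inner_bilin hu hw.inL4, inner_bilin hv hw.inL4]
    rw [trilin_self_eq_zero hv4 hw] at h2
    change _ = trilin ((u : L2) - v) _ _
    linarith
  rw [h3]
  exact abs_trilin_le hw _

/-! ### The spectral projection -/

theorem integral_partialDeriv_eq_zero {ψ : Plane → ℝ} (hψ : IsTest ψ) (j : Fin 2) :
    ∫ x, partialDeriv j ψ x ∂cellMeasure = 0 := by
  have hmp := measurePreserving_planePoint
  have hd : Differentiable ℝ ψ := hψ.1.differentiable (by simp)
  have hc := continuous_partialDeriv hψ j
  have hi : Integrable (fun p => partialDeriv j ψ (planePoint p)) (sideMeasure.prod sideMeasure) :=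
    hmp.integrable_comp_of_integrable (integrable_of_continuous hc)
  rw [← hmp.map_eq, integral_map hmp.measurable.aemeasurable hc.aestronglyMeasurable]
  have hftc : ∀ g g' : ℝ → ℝ, (∀ s, HasDerivAt g (g' s) s) → Continuous g' →
      g (2 * Real.pi) = g 0 → ∫ s in Ioo 0 (2 * Real.pi), g' s = 0 := by
    intro g g' hg hg' h0
    rw [← integral_Ioc_eq_integral_Ioo, ← intervalIntegral.integral_of_le (by positivity),
      intervalIntegral.integral_eq_sub_of_hasDerivAt (fun r _ => hg r)
      (hg'.intervalIntegrable _ _), h0, sub_self]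
  fin_cases j
  · rw [integral_prod_symm _ hi]
    refine integral_eq_zero_of_ae (ae_of_all _ fun b => ?_)
    refine hftc _ _ (fun s => hasDerivAt_planePoint_fst hd s b)
      (hc.comp (continuous_planePoint.comp (by fun_prop : Continuous fun s : ℝ => (s, b)))) ?_
    rw [← hψ.2 0 (planePoint (0, b))]
    congr 1
    ext i
    fin_cases i <;> simp [planePoint]
  · rw [integral_prod _ hi]
    refine integral_eq_zero_of_ae (ae_of_all _ fun a => ?_)
    refine hftc _ _ (fun s => hasDerivAt_planePoint_snd hd a s)
      (hc.comp (continuous_planePoint.comp (by fun_prop : Continuous fun s : ℝ => (a, s)))) ?_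
    rw [← hψ.2 1 (planePoint (a, 0))]
    congr 1
    ext i
    fin_cases i <;> simp [planePoint]

/-- The vector field `Re (z e^{i k·x}) (-k_1, k_0)`. -/
def solenoidalMode (z : ℂ) (k : Fin 2 → ℤ) (x : Plane) : Plane :=
  reMode z k x • WithLp.toLp 2 ![-(k 1 : ℝ), k 0]

theorem memLp_solenoidalMode (z : ℂ) (k : Fin 2 → ℤ) :
    MemLp (solenoidalMode z k) 2 cellMeasure := by
  have hc : Continuous (solenoidalMode z k) :=
    (isTest_reMode z k).1.continuous.smul continuous_const
  obtain ⟨C, hC⟩ := isBounded_cell.isCompact_closure.exists_bound_of_continuousOn hc.continuousOn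
  exact MemLp.of_bound hc.aestronglyMeasurable C
    ((ae_restrict_mem measurableSet_cell).mono fun x hx => hC x (subset_closure hx))

theorem integral_conj_expMode_mul {k l : Fin 2 → ℤ} (h : k ≠ l) :
    ∫ x, starRingEnd ℂ (expMode k x) * expMode l x ∂cellMeasure = 0 := by
  have h1 : inner ℂ (modeLp k) (modeLp l) = 0 := orthonormal_modeLp.2 h
  rw [inner_modeLp] at h1
  have h2 : ∫ x, starRingEnd ℂ (expMode k x) * modeLp l x ∂cellMeasure =
      ((2 * Real.pi)⁻¹ : ℂ) * ∫ x, starRingEnd ℂ (expMode k x) * expMode l x ∂cellMeasure := by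
    rw [← integral_const_mul]
    refine integral_congr_ae ?_
    filter_upwards [coeFn_modeLp l] with x hx
    rw [hx]; ring
  have h3 : ((2 * Real.pi)⁻¹ : ℂ) ≠ 0 := by simp [Real.pi_ne_zero]
  rw [h2] at h1
  exact (mul_eq_zero.1 ((mul_eq_zero.1 h1).resolve_left h3)).resolve_left h3

theorem conj_expMode (k : Fin 2 → ℤ) (x : Plane) :
    starRingEnd ℂ (expMode k x) = expMode (-k) x := by
  rw [expMode, expMode, ← Complex.exp_conj]
  congr 1
  rw [map_mul, Complex.conj_I, Complex.conj_ofReal, inner_waveVec, inner_waveVec]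
  simp only [Pi.neg_apply]
  push_cast
  ring

theorem reMode_eq (z : ℂ) (k : Fin 2 → ℤ) (x : Plane) :
    (reMode z k x : ℂ) = 2⁻¹ * (z * expMode k x + starRingEnd ℂ z * expMode (-k) x) := by
  rw [reMode, Complex.re_eq_add_conj, map_mul, conj_expMode]
  ring

theorem integral_conj_expMode_mul_reMode {k l : Fin 2 → ℤ} (h : k ≠ l) (h' : k ≠ -l) (z : ℂ) :
    ∫ x, starRingEnd ℂ (expMode k x) * (reMode z l x : ℂ) ∂cellMeasure = 0 := by
  have hi : ∀ l, Integrable (fun x => starRingEnd ℂ (expMode k x) * expMode l x) cellMeasure :=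
    fun l => integrable_of_continuous
      ((Complex.continuous_conj.comp (continuous_expMode k)).mul (continuous_expMode l))
  have : ∀ x, starRingEnd ℂ (expMode k x) * (reMode z l x : ℂ) =
      2⁻¹ * z * (starRingEnd ℂ (expMode k x) * expMode l x) +
      2⁻¹ * starRingEnd ℂ z * (starRingEnd ℂ (expMode k x) * expMode (-l) x) := fun x => by
    rw [reMode_eq]; ring
  simp only [this]
  rw [integral_add ((hi l).const_mul _) ((hi (-l)).const_mul _), integral_const_mul,
    integral_const_mul, integral_conj_expMode_mul h, integral_conj_expMode_mul h']
  simp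

theorem expMode_zero (x : Plane) : expMode 0 x = 1 := by
  rw [expMode, inner_waveVec]; simp

theorem isMeanFree_solenoidalMode (z : ℂ) {k : Fin 2 → ℤ} (hk : k ≠ 0) :
    IsMeanFree ((memLp_solenoidalMode z k).toLp) := by
  have h1 := integral_conj_expMode_mul_reMode (k := 0) (l := k) hk.symm
    (neg_ne_zero.2 hk).symm z
  simp only [expMode_zero, map_one, one_mul] at h1
  have h2 : ∫ x, (reMode z k x : ℂ) ∂cellMeasure = ((∫ x, reMode z k x ∂cellMeasure : ℝ) : ℂ) :=
    integral_ofReal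
  rw [h2, Complex.ofReal_eq_zero] at h1
  rw [IsMeanFree, integral_congr_ae (memLp_solenoidalMode z k).coeFn_toLp]
  simp only [solenoidalMode]
  rw [integral_smul_const, h1, zero_smul]

theorem isDivFree_solenoidalMode (z : ℂ) (k : Fin 2 → ℤ) :
    IsDivFree ((memLp_solenoidalMode z k).toLp) := by
  intro φ hφ
  have hψ : IsTest fun x => φ x * reMode z k x :=
    ⟨hφ.1.mul (isTest_reMode z k).1, fun j x => by
      simp only [hφ.2, (isTest_reMode z k).2]⟩
  have hp : ∀ j x, partialDeriv j (fun x => φ x * reMode z k x) x =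
      φ x * reMode (z * (Complex.I * k j)) k x + partialDeriv j φ x * reMode z k x := by
    intro j x
    have h1 := (hφ.1.differentiable (by simp) x).hasFDerivAt
    have h2 := ((isTest_reMode z k).1.differentiable (by simp) x).hasFDerivAt
    rw [partialDeriv, (h1.fun_mul h2).fderiv, ← partialDeriv_reMode]
    simp only [add_apply, smul_apply, smul_eq_mul, partialDeriv]
    ring
  have h0 := integral_partialDeriv_eq_zero hψ 0
  have h1 := integral_partialDeriv_eq_zero hψ 1
  have hi := fun j => integrable_of_continuous (continuous_partialDeriv hψ j)
  -- The mode is constant in the direction `(-k_1, k_0)`, so its derivative in that direction drops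
  -- out and the integrand is a directional derivative of the periodic product `φ · reMode z k`.
  calc _ = ∫ x, (-(k 1 : ℝ) * partialDeriv 0 (fun x => φ x * reMode z k x) x +
        (k 0 : ℝ) * partialDeriv 1 (fun x => φ x * reMode z k x) x) ∂cellMeasure := by
        refine integral_congr_ae ?_
        filter_upwards [(memLp_solenoidalMode z k).coeFn_toLp] with x hx
        simp only [hx, hp, Fin.sum_univ_two, solenoidalMode, PiLp.smul_apply, smul_eq_mul,
          Matrix.cons_val_zero, Matrix.cons_val_one]
        have hr : ∀ j, reMode (z * (Complex.I * k j)) k x =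
            k j * (z * Complex.I * expMode k x).re := fun j => by
          rw [← Complex.re_ofReal_mul, reMode]
          congr 1
          push_cast
          ring
        rw [hr, hr]
        ring
    _ = 0 := by
        rw [integral_add ((hi 0).const_mul _) ((hi 1).const_mul _), integral_const_mul,
          integral_const_mul, h0, h1]
        ring

/-- The field `Re (z e^{i k·x}) (-k_1, k_0)` as an element of `H`. -/
def solenoidalModeH (z : ℂ) {k : Fin 2 → ℤ} (hk : k ≠ 0) : H :=
  ⟨(memLp_solenoidalMode z k).toLp, isMeanFree_solenoidalMode z hk, isDivFree_solenoidalMode z k⟩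

theorem fourierCoeff_eq_inner (u : L2) (k : Fin 2 → ℤ) (j : Fin 2) :
    fourierCoeff u k j = ((2 * Real.pi)⁻¹ : ℂ) * inner ℂ (modeLp k) (comp j u) := by
  rw [inner_modeLp, fourierCoeff, ← mul_assoc, sq]
  congr 1
  refine integral_congr_ae ?_
  filter_upwards [coeFn_comp j u] with x hx
  rw [hx, expMode, ← Complex.exp_conj, map_mul, Complex.conj_I, Complex.conj_ofReal]

theorem norm_waveVec_neg (k : Fin 2 → ℤ) : ‖waveVec (-k)‖ = ‖waveVec k‖ := by
  have : waveVec (-k) = - waveVec k := by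
    ext j; simp [waveVec]
  rw [this, norm_neg]

theorem solenoidalModeH_mem {N : ℝ} (z : ℂ) {k : Fin 2 → ℤ} (hk : k ≠ 0) (hN : ‖waveVec k‖ ≤ N) :
    solenoidalModeH z hk ∈ lowModes N := by
  intro l hl j
  have hlk : l ≠ k := by rintro rfl; linarith
  have hlk' : l ≠ -k := by rintro rfl; rw [norm_waveVec_neg] at hl; linarith
  rw [fourierCoeff_eq_inner, inner_modeLp]
  have : ∫ x, starRingEnd ℂ (expMode l x) * comp j ((solenoidalModeH z hk : H) : L2) x
      ∂cellMeasure = (∫ x, starRingEnd ℂ (expMode l x) * (reMode z k x : ℂ) ∂cellMeasure) *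
        ((![-(k 1 : ℝ), k 0] j : ℝ) : ℂ) := by
    rw [← integral_mul_const]
    refine integral_congr_ae ?_
    filter_upwards [coeFn_comp j ((solenoidalModeH z hk : H) : L2),
      (memLp_solenoidalMode z k).coeFn_toLp] with x h1 h2
    rw [h1]
    change _ * ((((memLp_solenoidalMode z k).toLp : L2) x) j : ℂ) = _
    rw [h2, solenoidalMode, PiLp.smul_apply, smul_eq_mul]
    push_cast
    ring
  rw [this, integral_conj_expMode_mul_reMode hlk hlk']
  simp

/-- `PN` is defined abstractly as an orthogonal projection in `H`, so the vanishing of low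
coefficients of `q` has to be proved. Orthogonality to the solenoidal modes kills the part of the
coefficient along `(-k_1, k_0)`, the divergence condition kills the part along `k`, and these two
directions span when `k ≠ 0`. -/
theorem modeIntegral_eq_zero {N : ℝ} {q : H} (hq : ∀ v ∈ lowModes N, inner ℝ (q : H) v = 0)
    {k : Fin 2 → ℤ} (hk : ‖waveVec k‖ ≤ N) (i : Fin 2) : modeIntegral k i (q : L2) = 0 := by
  by_cases h0 : k = 0
  · rw [h0, modeIntegral_zero q.2.1]
  have hdiv := q.2.2.sum_mul_modeIntegral k
  have horth : ∀ z : ℂ, (z * (-(k 1 : ℂ) * modeIntegral k 0 (q : L2) +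
      k 0 * modeIntegral k 1 (q : L2))).re = 0 := by
    intro z
    have h1 := hq _ (solenoidalModeH_mem z h0 hk)
    have h2 : inner ℝ q (solenoidalModeH z h0) =
        ∫ x, (-(k 1 : ℝ) * (reMode z k x * (q : L2) x 0) +
          (k 0 : ℝ) * (reMode z k x * (q : L2) x 1)) ∂cellMeasure := by
      change inner ℝ (q : L2) ((memLp_solenoidalMode z k).toLp) = _
      rw [L2.inner_def]
      refine integral_congr_ae ?_
      filter_upwards [(memLp_solenoidalMode z k).coeFn_toLp] with x hx
      rw [hx]
      simp only [PiLp.inner_apply, Fin.sum_univ_two, solenoidalMode, PiLp.smul_apply, smul_eq_mul,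
        Matrix.cons_val_zero, Matrix.cons_val_one, RCLike.inner_apply, conj_trivial]
      ring
    rw [h2, integral_add ((integrable_reMode_mul z k 0 _).const_mul _)
      ((integrable_reMode_mul z k 1 _).const_mul _), integral_const_mul, integral_const_mul,
      integral_reMode_mul, integral_reMode_mul, ← Complex.re_ofReal_mul, ← Complex.re_ofReal_mul,
      ← Complex.add_re] at h1
    rw [← h1]
    congr 1
    push_cast
    ring
  have hperp := eq_zero_of_forall_re_mul horth
  rw [Fin.sum_univ_two] at hdiv
  have hksq : ((k 0 : ℂ) ^ 2 + (k 1 : ℂ) ^ 2) ≠ 0 := by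
    have h1 : (k 0) ^ 2 + (k 1) ^ 2 ≠ 0 := by
      intro h
      apply h0
      have h3 : k 0 = 0 := by nlinarith [sq_nonneg (k 0), sq_nonneg (k 1)]
      have h4 : k 1 = 0 := by nlinarith [sq_nonneg (k 0), sq_nonneg (k 1)]
      funext j
      fin_cases j
      exacts [h3, h4]
    exact_mod_cast h1
  refine (mul_eq_zero.1 (?_ : ((k 0 : ℂ) ^ 2 + (k 1 : ℂ) ^ 2) * _ = 0)).resolve_left hksq
  fin_cases i <;> simp only [Fin.zero_eta, Fin.mk_one]
  · linear_combination (k 0 : ℂ) * hdiv - (k 1 : ℂ) * hperp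
  · linear_combination (k 1 : ℂ) * hdiv + (k 0 : ℂ) * hperp

/-- The spectral gap above the wavenumber `N`. -/
theorem IsGrad.mul_norm_sq_sub_le {N : ℝ} (hN : 0 ≤ N) {w : H} {d : Fin 2 → L2} (hw : IsGrad w d) :
    N ^ 2 * (‖w‖ ^ 2 - ‖PN N w‖ ^ 2) ≤ gradNorm d ^ 2 := by
  set q := w - PN N w with hq
  have hmem : PN N w ∈ lowModes N := Submodule.starProjection_apply_mem _ w
  have horth : ∀ v ∈ lowModes N, inner ℝ q v = 0 := fun v hv =>
    Submodule.starProjection_inner_eq_zero w v hv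
  have hpyth : ‖w‖ ^ 2 - ‖PN N w‖ ^ 2 = ‖q‖ ^ 2 := by
    have h1 : w = q + PN N w := by rw [hq]; abel
    have h2 := norm_add_sq_real q (PN N w)
    rw [← h1, horth _ hmem] at h2
    linarith
  rw [hpyth, gradNorm_sq]
  change N ^ 2 * ‖(q : L2)‖ ^ 2 ≤ _
  rw [norm_sq_eq_sum_comp]
  simp only [norm_sq_eq_sum_comp (d _)]
  rw [Finset.sum_comm, Finset.mul_sum]
  refine Finset.sum_le_sum fun i _ =>
    IsFourierDeriv.mul_norm_sq_le (fun j => hw.comp i j) fun k => ?_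
  -- At low wavenumbers the coefficients of `q` vanish. At high ones those of `PN N w` vanish, so
  -- `q` and `w` have the same coefficient and `N² ≤ |k|²`.
  by_cases hk : ‖waveVec k‖ ≤ N
  · rw [inner_modeLp_comp, modeIntegral_eq_zero horth hk]
    simp only [map_zero, mul_zero, norm_zero, ne_eq, OfNat.ofNat_ne_zero, not_false_eq_true,
      zero_pow]
    positivity
  · rw [not_le] at hk
    have h1 := hmem k hk i
    rw [fourierCoeff_eq_inner] at h1
    have h3 : ((2 * Real.pi)⁻¹ : ℂ) ≠ 0 := by simp [Real.pi_ne_zero]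
    have h2 : inner ℂ (modeLp k) (NSE.comp i (q : L2)) =
        inner ℂ (modeLp k) (NSE.comp i (w : L2)) := by
      have : (q : L2) = (w : L2) - (PN N w : H) := rfl
      rw [this, map_sub, inner_sub_right, (mul_eq_zero.1 h1).resolve_left h3, sub_zero]
    rw [h2]
    gcongr

/-! ### Absolutely continuous functions and Gronwall's inequality -/

theorem absolutelyContinuousOnInterval_of_dist_le {X Y : Type*} [PseudoMetricSpace X]
    [PseudoMetricSpace Y] {f : ℝ → X} {g : ℝ → Y} {a b C : ℝ}
    (hg : AbsolutelyContinuousOnInterval g a b)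
    (h : ∀ s ∈ uIcc a b, ∀ t ∈ uIcc a b, dist (f s) (f t) ≤ C * dist (g s) (g t)) :
    AbsolutelyContinuousOnInterval f a b := by
  have hC := Tendsto.const_mul C hg
  rw [mul_zero] at hC
  refine squeeze_zero' (Eventually.of_forall fun E => Finset.sum_nonneg fun _ _ => dist_nonneg)
    ?_ hC
  filter_upwards [mem_inf_of_right (mem_principal_self _)] with E hE
  rw [Finset.mul_sum]
  exact Finset.sum_le_sum fun i hi => h _ (hE.1 i hi).1 _ (hE.1 i hi).2

/-- On a compact interval `φ` is bounded above by some `M`, and `exp` is Lipschitz with constant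
`exp M` on `(-∞, M]`. -/
theorem absolutelyContinuousOnInterval_exp {φ : ℝ → ℝ} {a b : ℝ}
    (hφ : AbsolutelyContinuousOnInterval φ a b) :
    AbsolutelyContinuousOnInterval (fun t => Real.exp (φ t)) a b := by
  obtain ⟨M, hM⟩ := hφ.exists_bound
  have key : ∀ x y : ℝ, x ≤ M → Real.exp x - Real.exp y ≤ Real.exp M * |x - y| := by
    intro x y hx
    have h1 : Real.exp y = Real.exp x * Real.exp (y - x) := by rw [← Real.exp_add]; congr 1; ring
    have h2 := Real.add_one_le_exp (y - x)
    have h3 : Real.exp x - Real.exp y ≤ Real.exp x * (x - y) := by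
      rw [h1]; nlinarith [Real.exp_pos x]
    calc _ ≤ Real.exp x * |x - y| := h3.trans (by gcongr; exact le_abs_self _)
      _ ≤ _ := by gcongr
  refine absolutelyContinuousOnInterval_of_dist_le (C := Real.exp M) hφ fun s hs t ht => ?_
  have h1 : φ s ≤ M := (Real.le_norm_self _).trans (hM s hs)
  have h2 : φ t ≤ M := (Real.le_norm_self _).trans (hM t ht)
  rw [Real.dist_eq, Real.dist_eq, abs_sub_le_iff]
  exact ⟨key _ _ h1, by rw [abs_sub_comm]; exact key _ _ h2⟩

/-- Gronwall's inequality for absolutely continuous functions. -/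
theorem gronwall_exp_le {y : ℝ → ℝ} (hy : ∀ T, 0 < T → AbsolutelyContinuousOnInterval y 0 T)
    {κ C T₀ : ℝ} (hκ : 0 < κ) (hC : 0 ≤ C) (hT₀ : 0 ≤ T₀)
    (hd : ∀ᵐ t, T₀ < t → ∃ y', HasDerivAt y y' t ∧ y' ≤ -κ * y t + C) {t : ℝ} (ht : T₀ ≤ t) :
    y t ≤ Real.exp (-κ * (t - T₀)) * y T₀ + C / κ := by
  rcases ht.eq_or_lt with rfl | hlt
  · simp only [sub_self, mul_zero, Real.exp_zero, one_mul]
    linarith [div_nonneg hC hκ.le]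
  -- Integrating factor: subtracting the equilibrium `C / κ` makes the inequality homogeneous, so
  -- `h` has a nonpositive derivative almost everywhere. Absolute continuity turns this into
  -- monotonicity between the endpoints.
  set h : ℝ → ℝ := fun t => Real.exp (κ * t) * (y t - C / κ) with hh
  have hyT : AbsolutelyContinuousOnInterval y T₀ t := (hy t (hT₀.trans_lt hlt)).mono (by
    rw [uIcc_of_le ht, uIcc_of_le (hT₀.trans ht)]
    exact Icc_subset_Icc_left hT₀)
  have hAC : AbsolutelyContinuousOnInterval h T₀ t := by
    refine AbsolutelyContinuousOnInterval.fun_mul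
      (f := fun t => Real.exp (κ * t)) (g := fun t => y t - C / κ) ?_ ?_
    · exact ContDiffOn.absolutelyContinuousOnInterval (by fun_prop)
    · exact hyT.sub (g := fun _ => C / κ) (ContDiffOn.absolutelyContinuousOnInterval (by fun_prop))
  have hder : ∀ᵐ s, T₀ < s → deriv h s ≤ 0 := by
    filter_upwards [hd] with s hs hs0
    obtain ⟨y', h1, h2⟩ := hs hs0
    have h3 : HasDerivAt (fun t => Real.exp (κ * t)) (Real.exp (κ * s) * κ) s := by
      simpa using ((hasDerivAt_id s).const_mul κ).exp
    have h4 : HasDerivAt h _ s := h3.mul (h1.sub_const (C / κ))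
    rw [h4.deriv]
    have h5 : Real.exp (κ * s) * κ * (y s - C / κ) + Real.exp (κ * s) * y' =
        Real.exp (κ * s) * (κ * y s - C + y') := by
      field_simp
    rw [h5]
    exact mul_nonpos_of_nonneg_of_nonpos (Real.exp_pos _).le (by linarith)
  have hint := hAC.integral_deriv_eq_sub
  have hle : ∫ s in T₀..t, deriv h s ≤ 0 := by
    rw [intervalIntegral.integral_of_le ht]
    refine integral_nonpos_of_ae ?_
    filter_upwards [ae_restrict_of_ae hder, ae_restrict_mem measurableSet_Ioc] with s h1 h2
    exact h1 h2.1
  rw [hint] at hle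
  have h6 : Real.exp (κ * t) * (y t - C / κ) ≤ Real.exp (κ * T₀) * (y T₀ - C / κ) := by
    simpa [hh] using hle
  have h7 : Real.exp (-κ * (t - T₀)) * Real.exp (κ * t) = Real.exp (κ * T₀) := by
    rw [← Real.exp_add]; congr 1; ring
  rw [← h7, mul_comm (Real.exp (-κ * (t - T₀))), mul_assoc] at h6
  have h8 := le_of_mul_le_mul_left h6 (Real.exp_pos _)
  have h9 : 0 ≤ Real.exp (-κ * (t - T₀)) * (C / κ) :=
    mul_nonneg (Real.exp_pos _).le (div_nonneg hC hκ.le)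
  linarith

/-- Gronwall with rate `1` started at `T₀`: the initial value decays and the source contributes at
most `ε / 2`. -/
theorem tendsto_zero_of_gronwall {y : ℝ → ℝ} (h0 : ∀ t, 0 ≤ t → 0 ≤ y t)
    (hy : ∀ T, 0 < T → AbsolutelyContinuousOnInterval y 0 T)
    (hd : ∀ ε, 0 < ε → ∃ T₀, 0 ≤ T₀ ∧
      ∀ᵐ t, T₀ < t → ∃ y', HasDerivAt y y' t ∧ y' ≤ -y t + ε) :
    Tendsto y atTop (𝓝 0) := by
  rw [Metric.tendsto_atTop]
  intro ε hε
  obtain ⟨T₀, hT₀, h⟩ := hd (ε / 2) (by positivity)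
  have hlim : Tendsto (fun t => Real.exp (-1 * (t - T₀)) * y T₀) atTop (𝓝 0) := by
    have h1 : Tendsto (fun t : ℝ => Real.exp (-1 * (t - T₀))) atTop (𝓝 0) := by
      refine Real.tendsto_exp_atBot.comp ?_
      exact (tendsto_atTop_add_const_right atTop (-T₀) tendsto_id).const_mul_atTop_of_neg
        (by norm_num)
    simpa using h1.mul_const (y T₀)
  obtain ⟨T₁, hT₁⟩ := eventually_atTop.1 (hlim.eventually_lt_const (half_pos hε))
  refine ⟨max T₀ T₁, fun t ht => ?_⟩
  have h2 := gronwall_exp_le hy (κ := 1) one_pos (half_pos hε).le hT₀ (by simpa using h)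
    ((le_max_left _ _).trans ht)
  have h3 := hT₁ t ((le_max_right _ _).trans ht)
  rw [Real.dist_eq, sub_zero, abs_of_nonneg (h0 t (hT₀.trans ((le_max_left _ _).trans ht)))]
  rw [div_one] at h2
  linarith

/-! ### Primitives -/

/-- `w` is the primitive on `[0, ∞)` of the locally integrable function `w'`. -/
structure IsPrimitive (w w' : ℝ → H) : Prop where
  integrable : ∀ T, 0 < T → IntervalIntegrable w' volume 0 T
  eq : ∀ t, 0 ≤ t → w t = w 0 + ∫ s in (0 : ℝ)..t, w' s

theorem IsPrimitive.sub {w w' v v' : ℝ → H} (hw : IsPrimitive w w') (hv : IsPrimitive v v') :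
    IsPrimitive (fun t => w t - v t) (fun t => w' t - v' t) := by
  refine ⟨fun T hT => (hw.integrable T hT).sub (hv.integrable T hT), fun t ht => ?_⟩
  rcases ht.eq_or_lt with rfl | hlt
  · simp
  · rw [intervalIntegral.integral_sub (hw.integrable t hlt) (hv.integrable t hlt), hw.eq t ht,
      hv.eq t ht]
    abel

/-- Lebesgue differentiation on each `[0, n + 1]`; countably many exceptional null sets are
discarded. The formula for `w` holds only for nonnegative times, hence `0 < t`. -/
theorem IsPrimitive.ae_hasDerivAt {w w' : ℝ → H} (h : IsPrimitive w w') :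
    ∀ᵐ t, 0 < t → HasDerivAt w (w' t) t := by
  have h1 : ∀ᵐ t, ∀ n : ℕ, t ∈ uIcc (0 : ℝ) (n + 1) → ∀ c ∈ uIcc (0 : ℝ) (n + 1),
      HasDerivAt (fun x => ∫ s in c..x, w' s) (w' t) t :=
    ae_all_iff.2 fun n => (h.integrable (n + 1) (by positivity)).ae_hasDerivAt_integral
  filter_upwards [h1] with t ht ht0
  obtain ⟨n, hn⟩ := exists_nat_ge t
  have hu : uIcc (0 : ℝ) ((n : ℝ) + 1) = Icc (0 : ℝ) ((n : ℝ) + 1) := uIcc_of_le (by positivity)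
  have h2 := ht n (by rw [hu]; exact ⟨ht0.le, by linarith⟩) 0 (by simp)
  refine (h2.const_add (w 0)).congr_of_eventuallyEq ?_
  filter_upwards [lt_mem_nhds ht0] with s hs
  exact h.eq s hs.le

/-- Increments of `w` are dominated by those of the absolutely continuous function `∫ ‖w'‖`, and
squaring is Lipschitz on the bounded range of `‖w‖`. -/
theorem IsPrimitive.absolutelyContinuous_norm_sq {w w' : ℝ → H} (h : IsPrimitive w w') {T : ℝ}
    (hT : 0 < T) : AbsolutelyContinuousOnInterval (fun t => ‖w t‖ ^ 2) 0 T := by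
  have hn := (h.integrable T hT).norm
  have hG := hn.absolutelyContinuousOnInterval_intervalIntegral (c := 0) (by simp)
  obtain ⟨M, hM⟩ := hG.exists_bound
  have hdist : ∀ s ∈ uIcc 0 T, ∀ t ∈ uIcc 0 T, ‖w s - w t‖ ≤
      dist (∫ r in (0 : ℝ)..s, ‖w' r‖) (∫ r in (0 : ℝ)..t, ‖w' r‖) := by
    intro s hs t ht
    have hi : ∀ t ∈ uIcc 0 T, IntervalIntegrable w' volume 0 t := fun t ht =>
      (h.integrable T hT).mono_set (uIcc_subset_uIcc (by simp) ht)
    have hs0 : 0 ≤ s := by rw [uIcc_of_le hT.le] at hs; exact hs.1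
    have ht0 : 0 ≤ t := by rw [uIcc_of_le hT.le] at ht; exact ht.1
    rw [h.eq s hs0, h.eq t ht0, add_sub_add_left_eq_sub, Real.dist_eq,
      intervalIntegral.integral_interval_sub_left (hi s hs) (hi t ht),
      intervalIntegral.integral_interval_sub_left (hi s hs).norm (hi t ht).norm]
    exact intervalIntegral.norm_integral_le_abs_integral_norm
  have hb : ∀ t ∈ uIcc 0 T, ‖w t‖ ≤ ‖w 0‖ + M := by
    intro t ht
    have h1 := hdist t ht 0 (by simp)
    rw [intervalIntegral.integral_same, dist_zero_right] at h1
    have h2 : ‖w t‖ ≤ ‖w 0‖ + ‖w t - w 0‖ := by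
      simpa using norm_add_le (w 0) (w t - w 0)
    linarith [hM t ht]
  refine absolutelyContinuousOnInterval_of_dist_le (C := 2 * (‖w 0‖ + M)) hG fun s hs t ht => ?_
  have h1 : |‖w s‖ - ‖w t‖| ≤ _ := (abs_norm_sub_norm_le _ _).trans (hdist s hs t ht)
  have h2 : ‖w s‖ + ‖w t‖ ≤ 2 * (‖w 0‖ + M) := by linarith [hb s hs, hb t ht]
  rw [Real.dist_eq, sq_sub_sq, abs_mul, abs_of_nonneg (by positivity)]
  exact mul_le_mul h2 h1 (abs_nonneg _) ((add_nonneg (norm_nonneg _) (norm_nonneg _)).trans h2)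

/-! ### Energy estimates -/

theorem IsStrongSolution.exists_primitive {ν : ℝ} {F : ℝ → H} {u₀ : H} {u : ℝ → H}
    (h : IsStrongSolution ν F u₀ u) : ∃ u' : ℝ → H, IsPrimitive u u' ∧
      ∀ᵐ t, 0 < t → InDA (u t) ∧ u' t = F t - ν • stokes (u t) - bilin (u t) (u t) := by
  obtain ⟨u', h1, h2, h3⟩ := h.equation
  refine ⟨u', ⟨fun T hT => ?_, fun t ht => by rw [h.init]; exact h2 t ht⟩, ?_⟩
  · rw [intervalIntegrable_iff_integrableOn_Ioo_of_le hT.le]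
    exact (h1 T hT).integrable (by norm_num)
  · filter_upwards [(ae_restrict_iff' measurableSet_Ioi).1 h3,
      (ae_restrict_iff' measurableSet_Ioi).1 h.mem_DA] with t h4 h5 ht
    exact ⟨h5 ht, by rw [← h4 ht]; abel⟩

theorem ae_norm_le_forceNorm {f : ℝ → H} (hf : IsForce f) :
    ∀ᵐ t, 0 < t → ‖f t‖ ≤ forceNorm f := by
  have h : ∀ᵐ t ∂volume.restrict (Ioi (0 : ℝ)), ‖f t‖ ≤ forceNorm f := by
    filter_upwards [ae_le_eLpNormEssSup (f := f) (μ := volume.restrict (Ioi (0 : ℝ)))] with t ht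
    rw [← eLpNorm_exponent_top] at ht
    have := ENNReal.toReal_mono hf.2.ne ht
    rwa [toReal_enorm] at this
  exact (ae_restrict_iff' measurableSet_Ioi).1 h

theorem inner_smul_right_H (u v : H) (r : ℝ) : inner ℝ u (r • v) = r * inner ℝ u v :=
  real_inner_smul_right u v r

/-- The nonlinear term is orthogonal to `u`. Poincaré and Young spend half of the dissipation `2ν
|∇u|²` on the force; the other half is kept, since it later supplies the cancellation. -/
theorem inner_energy_le {ν F : ℝ} (hν : 0 < ν) {u f : H} (hu : InDA u) (hf : ‖f‖ ≤ F) :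
    2 * inner ℝ u (f - ν • stokes u - bilin u u) ≤
      -ν * gradNorm (fun j => weakPartial j (u : L2)) ^ 2 + F ^ 2 / ν := by
  set E := gradNorm (fun j => weakPartial j (u : L2))
  have hP : ‖u‖ ≤ E := hu.1.isGrad.norm_le
  have hE0 : 0 ≤ E := gradNorm_nonneg _
  have h1 : inner ℝ u f ≤ E * F :=
    (real_inner_le_norm u f).trans (mul_le_mul hP hf (norm_nonneg _) hE0)
  rw [inner_sub_right, inner_sub_right, inner_smul_right_H, real_inner_comm (stokes u) u,
    real_inner_comm (bilin u u) u, inner_stokes_self hu, inner_bilin_self hu]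
  have h2 : 2 * (E * F) ≤ ν * E ^ 2 + F ^ 2 / ν := by
    have h3 : 0 ≤ (ν * E - F) ^ 2 / ν := by positivity
    have h4 : (ν * E - F) ^ 2 / ν = ν * E ^ 2 - 2 * (E * F) + F ^ 2 / ν := by field_simp; ring
    linarith
  linarith

theorem norm_sq_le_of_isStrongSolution {ν : ℝ} (hν : 0 < ν) {f : ℝ → H} (hf : IsForce f) {u₀ : H}
    {u : ℝ → H} (h : IsStrongSolution ν f u₀ u) {t : ℝ} (ht : 0 ≤ t) :
    ‖u t‖ ^ 2 ≤ ‖u₀‖ ^ 2 + forceNorm f ^ 2 / ν / ν := by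
  obtain ⟨u', hp, hu⟩ := h.exists_primitive
  have hg := gronwall_exp_le (fun T hT => hp.absolutelyContinuous_norm_sq hT) hν
    (by positivity : 0 ≤ forceNorm f ^ 2 / ν) le_rfl ?_ ht
  · rw [h.init, sub_zero] at hg
    have h1 : Real.exp (-ν * t) ≤ 1 := Real.exp_le_one_iff.2 (by nlinarith)
    nlinarith [sq_nonneg ‖u₀‖]
  · filter_upwards [hu, hp.ae_hasDerivAt, ae_norm_le_forceNorm hf] with s h1 h2 h3 hs
    obtain ⟨hDA, heq⟩ := h1 hs
    refine ⟨_, (h2 hs).norm_sq, ?_⟩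
    rw [heq]
    refine (inner_energy_le hν hDA (h3 hs)).trans ?_
    have hP : ‖u s‖ ^ 2 ≤ gradNorm (fun j => weakPartial j (u s : L2)) ^ 2 :=
      pow_le_pow_left₀ (norm_nonneg _) hDA.1.isGrad.norm_le 2
    nlinarith

/-- The dissipation `2ν D²` is split: one half absorbs the trilinear term by Young's inequality
(`144 = 12²`), the other becomes damping of the high modes through the spectral gap. -/
theorem inner_difference_le {ν N : ℝ} (hν : 0 < ν) (hN : 0 ≤ N) {u v f g : H} (hu : InDA u)
    (hv : InDA v) :
    2 * inner ℝ (u - v) ((f - ν • stokes u - bilin u u) - (g - ν • stokes v - bilin v v)) ≤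
      -(ν * N ^ 2) * (‖u - v‖ ^ 2 - ‖PN N u - PN N v‖ ^ 2) +
      144 / ν * gradNorm (fun j => weakPartial j (u : L2)) ^ 2 * ‖u - v‖ ^ 2 +
      2 * (‖f - g‖ * ‖u - v‖) := by
  set w := u - v with hw
  set D := gradNorm (fun j => weakPartial j (u : L2) - weakPartial j (v : L2)) with hD
  set E := gradNorm (fun j => weakPartial j (u : L2))
  have hgrad : IsGrad (w : L2) (fun j => weakPartial j (u : L2) - weakPartial j (v : L2)) :=
    hu.1.isGrad.sub hv.1.isGrad
  have h1 : (f - ν • stokes u - bilin u u) - (g - ν • stokes v - bilin v v) =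
      (f - g) - ν • (stokes u - stokes v) - (bilin u u - bilin v v) := by
    rw [smul_sub]; abel
  have h2 : inner ℝ w (f - g) ≤ ‖f - g‖ * ‖w‖ := by
    rw [mul_comm]; exact real_inner_le_norm _ _
  have h3 := inner_stokes_sub hu hv
  have h4 := (abs_le.1 (abs_inner_bilin_sub_le hu hv)).1
  have h5 := hgrad.mul_norm_sq_sub_le hN
  rw [hw, map_sub, ← hw, ← hD] at h5
  rw [← hw, ← hD] at h3 h4
  rw [h1, inner_sub_right, inner_sub_right, inner_smul_right_H,
    real_inner_comm (stokes u - stokes v) w, real_inner_comm (bilin u u - bilin v v) w, h3]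
  have h6 : 24 * (‖w‖ * D * E) ≤ ν * D ^ 2 + 144 / ν * E ^ 2 * ‖w‖ ^ 2 := by
    have h7 : 0 ≤ (ν * D - 12 * E * ‖w‖) ^ 2 / ν := by positivity
    have h8 : (ν * D - 12 * E * ‖w‖) ^ 2 / ν =
        ν * D ^ 2 - 24 * (‖w‖ * D * E) + 144 / ν * E ^ 2 * ‖w‖ ^ 2 := by field_simp; ring
    linarith
  have h9 := mul_le_mul_of_nonneg_left h5 hν.le
  linarith

/-! ### Determining modes -/

/-- Convergence along `atTop ⊓ ae` means smallness after some time outside a null set, which is the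
form that the almost-everywhere Gronwall inequality accepts. -/
theorem ForceTendsToZero.exists_forall_ae {f : ℝ → H} (hf : ForceTendsToZero f) {p : ℝ → ℝ}
    (hp : Tendsto p atTop (𝓝 0)) (a b : ℝ) {ε : ℝ} (hε : 0 < ε) :
    ∃ T₀, 0 ≤ T₀ ∧ ∀ᵐ t, T₀ < t → a * p t + b * ‖f t‖ ≤ ε := by
  have h := ((hp.mono_left (inf_le_left : atTop ⊓ ae (volume : Measure ℝ) ≤ atTop)).const_mul
    a).add (Tendsto.const_mul b hf)
  simp only [mul_zero, add_zero] at h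
  obtain ⟨s, hs, t, ht, hst⟩ := eventually_inf.1 (h.eventually_le_const hε)
  obtain ⟨T, hT⟩ := mem_atTop_sets.1 hs
  refine ⟨max T 0, le_max_right _ _, ?_⟩
  filter_upwards [ht] with r hr hTr
  exact hst r ⟨hT r ((le_max_left _ _).trans hTr.le), hr⟩

/-- The Foias-Prodi theorem: a sufficiently large number of Fourier modes is determining. -/
theorem determiningModes {ν : ℝ} (hν : 0 < ν) : DeterminingModes ν := by
  intro f₁ f₂ hf₁ hf₂
  set F := forceNorm f₁ with hF
  set G := 144 / ν ^ 2 * (F ^ 2 / ν) with hG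
  have hG0 : 0 ≤ G := by positivity
  -- This choice makes the damping `ν N²` exceed the growth rate `G` left by the weight by exactly
  -- one, and it depends only on `ν` and `|f₁|`.
  set N := √((1 + G) / ν) with hNdef
  have hNsq : ν * N ^ 2 = 1 + G := by
    rw [hNdef, Real.sq_sqrt (by positivity)]; field_simp
  refine ⟨N, Real.sqrt_pos.2 (by positivity), fun u₀₁ u₀₂ u₁ u₂ h₁ h₂ hlow hforce => ?_⟩
  obtain ⟨u₁', hp₁, hu₁⟩ := h₁.exists_primitive
  obtain ⟨u₂', hp₂, hu₂⟩ := h₂.exists_primitive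
  have hw := hp₁.sub hp₂
  obtain ⟨M₁, hM₁⟩ : ∃ M, ∀ t, 0 ≤ t → ‖u₁ t‖ ^ 2 ≤ M :=
    ⟨_, fun t ht => norm_sq_le_of_isStrongSolution hν hf₁ h₁ ht⟩
  obtain ⟨M₂, hM₂⟩ : ∃ M, ∀ t, 0 ≤ t → ‖u₂ t‖ ^ 2 ≤ M :=
    ⟨_, fun t ht => norm_sq_le_of_isStrongSolution hν hf₂ h₂ ht⟩
  -- The coefficient is such that the dissipation `-ν E²` in the energy inequality, multiplied by
  -- it, cancels the term `(144/ν) E² |w|²`.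
  set φ : ℝ → ℝ := fun t => 144 / ν ^ 2 * ‖u₁ t‖ ^ 2 with hφ
  set z : ℝ → ℝ := fun t => Real.exp (φ t) * ‖u₁ t - u₂ t‖ ^ 2 with hz
  set K := Real.exp (144 / ν ^ 2 * M₁)
  have hK : ∀ t, 0 ≤ t → Real.exp (φ t) ≤ K := fun t ht => Real.exp_le_exp.2
    (mul_le_mul_of_nonneg_left (hM₁ t ht) (by positivity))
  have hW : ∀ t, 0 ≤ t → ‖u₁ t - u₂ t‖ ≤ √M₁ + √M₂ := fun t ht =>
    (norm_sub_le _ _).trans (add_le_add (Real.le_sqrt_of_sq_le (hM₁ t ht))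
      (Real.le_sqrt_of_sq_le (hM₂ t ht)))
  have hzlim : Tendsto z atTop (𝓝 0) := by
    refine tendsto_zero_of_gronwall (fun t _ => by positivity) (fun T hT => ?_) fun ε hε => ?_
    · exact (absolutelyContinuousOnInterval_exp
        ((hp₁.absolutelyContinuous_norm_sq hT).const_mul _)).fun_mul
        (hw.absolutelyContinuous_norm_sq hT)
    · have hlow2 := hlow.pow 2
      rw [zero_pow two_ne_zero] at hlow2
      -- The factor `K` bounds the weight `exp φ`, which multiplies the remainder in the inequality
      -- for `z`; the sum of square roots bounds `|u₁ - u₂|` uniformly in time.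
      obtain ⟨T₀, hT₀, hsmall⟩ := hforce.exists_forall_ae hlow2
        (K * (ν * N ^ 2)) (K * (2 * (√M₁ + √M₂))) hε
      refine ⟨T₀, hT₀, ?_⟩
      filter_upwards [hsmall, hu₁, hu₂, hp₁.ae_hasDerivAt, hw.ae_hasDerivAt,
        ae_norm_le_forceNorm hf₁] with t hs h3 h4 h5 h6 h7 ht
      have ht0 : 0 < t := hT₀.trans_lt ht
      obtain ⟨hDA₁, he₁⟩ := h3 ht0
      obtain ⟨hDA₂, he₂⟩ := h4 ht0
      have hdφ : HasDerivAt φ _ t := ((h5 ht0).norm_sq).const_mul (144 / ν ^ 2)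
      have hdw := (h6 ht0).norm_sq
      refine ⟨_, hdφ.exp.mul hdw, ?_⟩
      have hen := inner_energy_le hν hDA₁ (h7 ht0)
      have hdi := inner_difference_le (f := f₁ t) (g := f₂ t) hν (Real.sqrt_nonneg _ : 0 ≤ N)
        hDA₁ hDA₂
      rw [← he₁, ← hF] at hen
      rw [← he₁, ← he₂, hNsq] at hdi
      replace hs := hs ht
      rw [hNsq] at hs
      set E := gradNorm (fun j => weakPartial j (u₁ t : L2))
      set W := ‖u₁ t - u₂ t‖ with hWdef
      set p := ‖PN N (u₁ t) - PN N (u₂ t)‖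
      have hen2 : 144 / ν ^ 2 * (2 * inner ℝ (u₁ t) (u₁' t)) ≤ -(144 / ν * E ^ 2) + G := by
        refine (mul_le_mul_of_nonneg_left hen (by positivity)).trans (le_of_eq ?_)
        rw [hG]
        field_simp
      have hW0 : 0 ≤ W := norm_nonneg _
      have hsum : 144 / ν ^ 2 * (2 * inner ℝ (u₁ t) (u₁' t)) * W ^ 2 +
          2 * inner ℝ (u₁ t - u₂ t) (u₁' t - u₂' t) ≤
          -W ^ 2 + ((1 + G) * p ^ 2 + 2 * (√M₁ + √M₂) * ‖f₁ t - f₂ t‖) := by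
        have e1 := mul_le_mul_of_nonneg_right hen2 (sq_nonneg W)
        have e2 : ‖f₁ t - f₂ t‖ * W ≤ ‖f₁ t - f₂ t‖ * (√M₁ + √M₂) :=
          mul_le_mul_of_nonneg_left (hW t ht0.le) (norm_nonneg _)
        linarith
      have hr0 : 0 ≤ (1 + G) * p ^ 2 + 2 * (√M₁ + √M₂) * ‖f₁ t - f₂ t‖ := by positivity
      calc _ = Real.exp (φ t) * (144 / ν ^ 2 * (2 * inner ℝ (u₁ t) (u₁' t)) * W ^ 2 +
            2 * inner ℝ (u₁ t - u₂ t) (u₁' t - u₂' t)) := by rw [hWdef]; ring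
        _ ≤ Real.exp (φ t) * (-W ^ 2 + ((1 + G) * p ^ 2 + 2 * (√M₁ + √M₂) * ‖f₁ t - f₂ t‖)) :=
            mul_le_mul_of_nonneg_left hsum (Real.exp_pos _).le
        _ = -z t + Real.exp (φ t) * ((1 + G) * p ^ 2 + 2 * (√M₁ + √M₂) * ‖f₁ t - f₂ t‖) := by
            simp only [hz]; ring
        _ ≤ -z t + K * ((1 + G) * p ^ 2 + 2 * (√M₁ + √M₂) * ‖f₁ t - f₂ t‖) := by
            gcongr
            exact hK t ht0.le
        _ ≤ -z t + ε := by linarith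
  -- Since `φ ≥ 0`, the weight is at least one and `z` dominates the squared difference.
  have hsq : Tendsto (fun t => ‖u₁ t - u₂ t‖ ^ 2) atTop (𝓝 0) :=
    squeeze_zero (fun t => by positivity) (fun t => le_mul_of_one_le_left (by positivity)
      (Real.one_le_exp (by positivity))) hzlim
  simpa using hsq.sqrt

/-! ### Determining modes as self-synchronization of the trivial intertwinement -/

theorem determiningModes_iff_trivialSelfSynchronous (ν : ℝ) :
    DeterminingModes ν ↔ TrivialSelfSynchronous ν := by
  have hF : ∀ (M : Matrix (Fin 2) (Fin 2) ℝ) (g : Fin 2 → ℝ → H) (v₀ : Fin 2 → H)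
      (v : Fin 2 → ℝ → H), IsIntertwinedSolution ν M (fun _ _ => 0) g v₀ v ↔
        ∀ i, IsStrongSolution ν (g i) (v₀ i) (v i) := by
    intro M g v₀ v
    simp [IsIntertwinedSolution]
  constructor
  · intro h M g hg
    obtain ⟨N, hN, h1⟩ := h (g 0) (g 1) (hg 0) (hg 1)
    refine ⟨N, hN, fun v₀ v hv => ?_⟩
    rw [hF] at hv
    exact h1 _ _ _ _ (hv 0) (hv 1)
  · intro h f₁ f₂ hf₁ hf₂
    obtain ⟨N, hN, h1⟩ := h 0 ![f₁, f₂] (by simp [Fin.forall_fin_two, hf₁, hf₂])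
    refine ⟨N, hN, fun u₀₁ u₀₂ u₁ u₂ hu₁ hu₂ => ?_⟩
    exact h1 ![u₀₁, u₀₂] ![u₁, u₂] ((hF _ _ _ _).2 (by simp [Fin.forall_fin_two, hu₁, hu₂]))

end NSE

end

theorem mainTheorem4 (ν : ℝ) (hν : 0 < ν) :
    (NSE.NudgingSynchronization ν → NSE.DeterminingModes ν) ∧
    (NSE.NudgingSynchronization ν → NSE.TrivialSelfSynchronous ν) ∧
    (NSE.DeterminingModes ν ↔ NSE.TrivialSelfSynchronous ν) :=
  ⟨fun _ => NSE.determiningModes hν,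
    fun _ => (NSE.determiningModes_iff_trivialSelfSynchronous ν).1 (NSE.determiningModes hν),
    NSE.determiningModes_iff_trivialSelfSynchronous ν⟩
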